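/- All linear spaces are real. An almost disjoint family is an infinite family of infinite subsets of $\mathbb{N}$, any two distinct members of which have finite intersection; it is maximal if it is maximal with respect to inclusion among almost disjoint families. For an almost disjoint family $\mathcal{F}$ let $K_{\mathcal{F}}$ be the Stone space of the Boolean algebra of subsets of $\mathbb{N}$ generated by $\mathcal{F}$ and the finite subsets of $\mathbb{N}$, i.e. the compact space of all Boolean homomorphisms from that algebra to $\{0,1\}$. Each $n\in\mathbb{N}$ is regarded as the point $A\mapsto 1_{A}(n)$ of $K_{\mathcal{F}}$, and $\infty\in K_{\mathcal{F}}$ is the homomorphism which vanishes on all members of $\mathcal{F}$ and on all finite sets. Let $\delta_t\in C(K_{\mathcal{F}})^*$ be the evaluation at $t\in K_{\mathcal{F}}$ and identify $\ell_1(\mathbb{N})$ with the subspace $\{\sum_{n}a_n\delta_n : \sum_n|a_n|<\infty\}$ of $C(K_{\mathcal{F}})^*$. Let $X$ be a Banach space. A subspace $Y\subset X^*$ is norming if $|||x|||=\sup\{x^*(x): x^*\in Y,\ \|x^*\|\le 1\}$ defines an equivalent norm on $X$. The Mackey topology $\mu(X,Y)$ is the topology on $X$ of uniform convergence on the absolutely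 convex $w^*$-compact subsets of $Y$. $X$ is fully Mackey complete if $(X,\mu(X,Y))$ is complete for every norming and norm-closed subspace $Y\subset X^*$. $X$ has property $(\mathcal{E}')$ if every convex, $w^*$-sequentially closed, bounded subset of $X^*$ is $w^*$-closed. Theorem. Assume the Continuum Hypothesis. Then there exists a maximal almost disjoint family $\mathcal{F}$ such that: (i) no sequence in $\ell_1(\mathbb{N})$ is $w^*$-convergent to $\delta_\infty$ in $C(K_{\mathcal{F}})^*$; (ii) $C(K_{\mathcal{F}})$ has property $(\mathcal{E}')$ but is not fully Mackey complete. -/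

import Mathlib

open Set Filter Topology

noncomputable section

/-! ### Stone spaces -/

/-- The Stone space of a Boolean algebra `B`: the set of all Boolean homomorphisms from `B` to the
two-element Boolean algebra, with the topology of pointwise convergence (the subspace topology
inherited from the product `B → Bool`). -/
def StoneSpace (B : Type*) [BooleanAlgebra B] : Type _ := BoundedLatticeHom B Bool

namespace StoneSpace

variable {B : Type*} [BooleanAlgebra B]

/-- A point of the Stone space as a function on the Boolean algebra. -/
def toFun (p : StoneSpace B) : B → Bool := fun a => (show BoundedLatticeHom B Bool from p) a

instance : TopologicalSpace (StoneSpace B) := TopologicalSpace.induced toFun inferInstance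

theorem toFun_injective : Function.Injective (toFun : StoneSpace B → B → Bool) := by
  intro p q h
  exact DFunLike.ext (F := BoundedLatticeHom B Bool) p q fun a => congrFun h a

theorem range_toFun : Set.range (toFun : StoneSpace B → B → Bool) =
    {φ | (∀ a b, φ (a ⊔ b) = (φ a ⊔ φ b)) ∧ (∀ a b, φ (a ⊓ b) = (φ a ⊓ φ b)) ∧
      φ ⊤ = ⊤ ∧ φ ⊥ = ⊥} := by
  ext φ
  constructor
  · rintro ⟨p, rfl⟩
    let q : BoundedLatticeHom B Bool := p
    exact ⟨fun a b => map_sup q a b, fun a b => map_inf q a b, map_top q, map_bot q⟩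
  · rintro ⟨h1, h2, h3, h4⟩
    exact ⟨({ toFun := φ, map_sup' := h1, map_inf' := h2, map_top' := h3, map_bot' := h4 } :
      BoundedLatticeHom B Bool), rfl⟩

instance : CompactSpace (StoneSpace B) := by
  have hind : IsInducing (toFun : StoneSpace B → B → Bool) := ⟨rfl⟩
  have hcl : IsClosed (Set.range (toFun : StoneSpace B → B → Bool)) := by
    rw [range_toFun]
    have hop : ∀ (m : Bool → Bool → Bool) (a b : B),
        Continuous fun φ : B → Bool => m (φ a) (φ b) := fun m a b => by
      have hm : Continuous fun x : Bool × Bool => m x.1 x.2 := continuous_of_discreteTopology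
      have hp : Continuous fun φ : B → Bool => (φ a, φ b) :=
        (continuous_apply a).prodMk (continuous_apply b)
      exact hm.comp hp
    simp only [Set.ofPred_and, Set.ofPred_forall]
    refine IsClosed.inter (isClosed_iInter fun a => isClosed_iInter fun b => ?_)
      (IsClosed.inter (isClosed_iInter fun a => isClosed_iInter fun b => ?_)
        (IsClosed.inter ?_ ?_))
    · exact isClosed_eq (continuous_apply _) (hop (· ⊔ ·) a b)
    · exact isClosed_eq (continuous_apply _) (hop (· ⊓ ·) a b)
    · exact isClosed_eq (continuous_apply _) continuous_const
    · exact isClosed_eq (continuous_apply _) continuous_const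
  rw [← isCompact_univ_iff, hind.isCompact_iff, Set.image_univ]
  exact hcl.isCompact

open Classical in
/-- The point of the Stone space, that is, the homomorphism to `Bool`, which takes the value `true`
exactly where `P` holds. -/
def ofPred (P : B → Prop) (hsup : ∀ a b, P (a ⊔ b) ↔ P a ∨ P b)
    (hinf : ∀ a b, P (a ⊓ b) ↔ P a ∧ P b) (htop : P ⊤) (hbot : ¬ P ⊥) : StoneSpace B :=
  ({ toFun := fun a => decide (P a)
     map_sup' := fun a b => by simp [hsup]
     map_inf' := fun a b => by simp [hinf]
     map_top' := by simp [htop]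
     map_bot' := by simp [hbot] } : BoundedLatticeHom B Bool)

theorem toFun_ofPred (P : B → Prop) (hsup hinf htop hbot) (a : B) :
    toFun (ofPred P hsup hinf htop hbot) a = true ↔ P a := by
  classical
  exact decide_eq_true_iff

end StoneSpace

/-! ### Almost disjoint families and their compact spaces -/

/-- An almost disjoint family: an infinite family of infinite subsets of `ℕ`, any two distinct
members of which have finite intersection. -/
def IsAlmostDisjointFamily (F : Set (Set ℕ)) : Prop :=
  F.Infinite ∧ (∀ N ∈ F, N.Infinite) ∧ F.Pairwise fun M N => (M ∩ N).Finite

/-- An almost disjoint family which is maximal, with respect to inclusion, among the almost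
disjoint families. -/
def IsMaximalAlmostDisjointFamily (F : Set (Set ℕ)) : Prop :=
  Maximal IsAlmostDisjointFamily F

/-- The Boolean algebra of subsets of `ℕ` generated by `F` and the finite subsets of `ℕ`. -/
def adAlgebra (F : Set (Set ℕ)) : BooleanSubalgebra (Set ℕ) :=
  BooleanSubalgebra.closure (F ∪ {s | s.Finite})

/-- The compact space `K_F`. -/
abbrev KSpace (F : Set (Set ℕ)) : Type := StoneSpace (adAlgebra F)

/-- The natural number `n` as a point of `K_F`: the homomorphism `A ↦ [n ∈ A]`. -/
def natPoint (F : Set (Set ℕ)) (n : ℕ) : KSpace F :=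
  StoneSpace.ofPred (fun A : adAlgebra F => n ∈ (A : Set ℕ))
    (fun _ _ => Iff.rfl) (fun _ _ => Iff.rfl) trivial (fun h => h)

/-- `A` is small if it is covered by finitely many members of `F` together with a finite set. -/
def IsSmall (F : Set (Set ℕ)) (A : Set ℕ) : Prop :=
  ∃ G : Set (Set ℕ), G ⊆ F ∧ G.Finite ∧ (A \ ⋃₀ G).Finite

theorem IsSmall.mono {F : Set (Set ℕ)} {A B : Set ℕ} (hB : IsSmall F B) (h : A ⊆ B) :
    IsSmall F A := by
  obtain ⟨G, h1, h2, h3⟩ := hB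
  exact ⟨G, h1, h2, h3.subset (Set.sdiff_subset_sdiff_left h)⟩

theorem IsSmall.union {F : Set (Set ℕ)} {A B : Set ℕ} (hA : IsSmall F A) (hB : IsSmall F B) :
    IsSmall F (A ∪ B) := by
  obtain ⟨G, h1, h2, h3⟩ := hA
  obtain ⟨H, k1, k2, k3⟩ := hB
  refine ⟨G ∪ H, Set.union_subset h1 k1, h2.union k2, (h3.union k3).subset ?_⟩
  rintro x ⟨hx | hx, hn⟩
  · exact Or.inl ⟨hx, fun h => hn (Set.sUnion_mono Set.subset_union_left h)⟩
  · exact Or.inr ⟨hx, fun h => hn (Set.sUnion_mono Set.subset_union_right h)⟩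

theorem isSmall_or_compl {F : Set (Set ℕ)} {A : Set ℕ} (hA : A ∈ adAlgebra F) :
    IsSmall F A ∨ IsSmall F Aᶜ := by
  have hfin : ∀ s : Set ℕ, s.Finite → IsSmall F s := fun s hs =>
    ⟨∅, Set.empty_subset _, Set.finite_empty, hs.subset Set.sdiff_subset⟩
  refine BooleanSubalgebra.closure_bot_sup_induction
    (p := fun A _ => IsSmall F A ∨ IsSmall F Aᶜ) ?_ ?_ ?_ ?_ hA
  · rintro x (hx | hx)
    · exact Or.inl ⟨{x}, by simpa using hx, Set.finite_singleton x, by simp⟩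
    · exact Or.inl (hfin x hx)
  · exact Or.inl (hfin _ Set.finite_empty)
  · rintro x - y - (hx | hx) hy
    · rcases hy with hy | hy
      · exact Or.inl (hx.union hy)
      · exact Or.inr (hy.mono (Set.compl_subset_compl.2 Set.subset_union_right))
    · exact Or.inr (hx.mono (Set.compl_subset_compl.2 Set.subset_union_left))
  · intro x _ hx
    rw [compl_compl]
    exact hx.symm

theorem not_isSmall_univ {F : Set (Set ℕ)} (hF : IsAlmostDisjointFamily F) :
    ¬ IsSmall F Set.univ := by
  rintro ⟨G, h1, h2, h3⟩
  obtain ⟨N, hN, hNG⟩ := hF.1.exists_notMem_finite h2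
  refine hF.2.1 N hN ?_
  have h4 : (⋃ M ∈ G, N ∩ M).Finite := h2.biUnion fun M hM =>
    hF.2.2 hN (h1 hM) fun h => hNG (h ▸ hM)
  refine (h3.union h4).subset fun x hx => ?_
  by_cases hxG : x ∈ ⋃₀ G
  · obtain ⟨M, hM, hxM⟩ := hxG
    exact Or.inr (Set.mem_biUnion hM ⟨hx, hxM⟩)
  · exact Or.inl ⟨trivial, hxG⟩

/-- The point `∞` of `K_F`: the homomorphism which vanishes on all members of `F` and all finite
sets, that is, exactly on the small sets. -/
def inftyPoint {F : Set (Set ℕ)} (hF : IsAlmostDisjointFamily F) : KSpace F :=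
  StoneSpace.ofPred (fun A : adAlgebra F => ¬ IsSmall F (A : Set ℕ))
    (fun A B => by
      rw [← not_and_or, not_iff_not]
      exact ⟨fun h => ⟨h.mono Set.subset_union_left, h.mono Set.subset_union_right⟩,
        fun h => h.1.union h.2⟩)
    (fun A B => by
      rw [← not_or, not_iff_not]
      refine ⟨fun h => ?_, fun h => h.elim (fun h => h.mono Set.inter_subset_left)
        (fun h => h.mono Set.inter_subset_right)⟩
      by_contra! hn
      have hA := (isSmall_or_compl A.2).resolve_left hn.1
      have hB := (isSmall_or_compl B.2).resolve_left hn.2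
      refine not_isSmall_univ hF (((hA.union hB).union h).mono fun x _ => ?_)
      by_cases h1 : x ∈ (A : Set ℕ)
      · by_cases h2 : x ∈ (B : Set ℕ)
        · exact Or.inr ⟨h1, h2⟩
        · exact Or.inl (Or.inr h2)
      · exact Or.inl (Or.inl h1))
    (not_isSmall_univ hF)
    (fun h => h ⟨∅, Set.empty_subset _, Set.finite_empty,
      Set.finite_empty.subset (fun _ hx => hx.1)⟩)

/-! ### Functionals on `C(K)` -/

/-- The topological dual of a real normed space, formed with respect to its norm topology. -/
abbrev NormedDual (X : Type*) [NormedAddCommGroup X] [NormedSpace ℝ X] : Type _ := StrongDual ℝ X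

/-- The evaluation functional `δ_t` on `C(K)`. -/
def diracFunctional {K : Type*} [TopologicalSpace K] [CompactSpace K] (t : K) :
    NormedDual C(K, ℝ) :=
  ContinuousMap.evalCLM ℝ t

/-- `ℓ₁(ℕ)` as a subset of `C(K_F)^*`: the sums, in norm, of the series `∑ a_n δ_n` over the points
`n ∈ ℕ ⊆ K_F`, where `a` is an absolutely summable sequence of real numbers. -/
def ell1Nat (F : Set (Set ℕ)) : Set (NormedDual C(KSpace F, ℝ)) :=
  {f | ∃ a : ℕ → ℝ, Summable (fun n => |a n|) ∧
    HasSum (fun n => a n • diracFunctional (natPoint F n)) f}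

/-! ### Mackey topologies -/

section Mackey

variable {X : Type*} [NormedAddCommGroup X] [NormedSpace ℝ X]

/-- The subspace `Y` of the dual is norming: `|||x||| = sup {f x : f ∈ Y, ‖f‖ ≤ 1}` is equivalent
to the norm of `X` (this supremum is taken over a bounded nonempty symmetric set and is always a
seminorm, so that only the two inequalities have to be required). -/
def IsNormingSubspace (Y : Submodule ℝ (NormedDual X)) : Prop :=
  ∃ c C : ℝ, 0 < c ∧ 0 < C ∧ ∀ x : X,
    c * ‖x‖ ≤ sSup ((fun f : NormedDual X => f x) '' {f | f ∈ Y ∧ ‖f‖ ≤ 1}) ∧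
    sSup ((fun f : NormedDual X => f x) '' {f | f ∈ Y ∧ ‖f‖ ≤ 1}) ≤ C * ‖x‖

/-- The absolutely convex `w^*`-compact subsets of `Y`. -/
def absConvexWeakStarCompacts (Y : Submodule ℝ (NormedDual X)) : Set (Set (WeakDual ℝ X)) :=
  {K | (∀ f ∈ K, WeakDual.toStrongDual f ∈ Y) ∧ AbsConvex ℝ K ∧ IsCompact K}

/-- The uniform structure of the Mackey topology `μ(X, Y)`: uniform convergence on the absolutely
convex `w^*`-compact subsets of `Y`, each `x : X` being regarded as the function `f ↦ f x`. -/
abbrev mackeyUniformSpace (Y : Submodule ℝ (NormedDual X)) : UniformSpace X :=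
  UniformSpace.comap
    (fun x : X => UniformOnFun.ofFun (absConvexWeakStarCompacts Y) fun f : WeakDual ℝ X => f x)
    inferInstance

variable (X)

/-- `X` is fully Mackey complete: `(X, μ(X, Y))` is complete for every norming and norm-closed
subspace `Y` of the dual. -/
def FullyMackeyComplete : Prop :=
  ∀ Y : Submodule ℝ (NormedDual X), IsNormingSubspace Y → IsClosed (Y : Set (NormedDual X)) →
    @CompleteSpace X (mackeyUniformSpace Y)

/-- Property `(E')`: every convex, `w^*`-sequentially closed and norm-bounded subset of the dual is
`w^*`-closed. -/
def HasPropertyEPrime : Prop :=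
  ∀ C : Set (NormedDual X), Convex ℝ C → Bornology.IsBounded C →
    IsSeqClosed (StrongDual.toWeakDual '' C) → IsClosed (StrongDual.toWeakDual '' C)

end Mackey

end

/-! The span of the functions `1`, `1_{k}` and `1_N` with `N ∈ F` is dense in `C(K_F)`, since
products of two generators again lie in it. Hence bounded sequences in the dual are tested on these
functions, of which only the `1_N` are uncountably many.

Avoiding `δ_∞`. A sequence in `ℓ₁(ℕ)` converging to `δ_∞` has total masses tending to 1 and masses
tending to 0 at each point and on each `N ∈ F`. If it looks so on a countable family, a gliding hump
yields an infinite set almost disjoint from that family on which the masses do not tend to 0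
(`exists_infinite_almostDisjoint_not_tendsto`). Under CH all sequences are treated in `ω₁` stages,
each preceded by countably many sets. Enlarging the family preserves the result, so Zorn's lemma
gives a maximal one.

Property (E') holds for every almost disjoint family. The dual ball is weak-star sequentially
compact, and a functional vanishing on all `1_{k}` is nonzero on only countably many `1_N`; a
closing-off argument then exhibits each point of the weak-star closure as a sequential limit.

Incompleteness. In `Y = ℓ₁(ℕ) ⊕ ℝ δ_∞` let `φ` be the coefficient of `δ_∞`. Weak-star compact
subsets of `Y` are metrizable, and a discontinuity of `φ` on one of them, once normalised, would
give a sequence in `ℓ₁(ℕ)` converging to `δ_∞`. So `φ` is continuous there, hence by Hahn–Banach a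
Mackey limit of evaluations. Completeness would make it the evaluation at some `x`; but `φ` kills
every `δ_n`, so `x = 0`, whereas `φ δ_∞ = 1`. -/

noncomputable section

/-! ### Indicator functions on `K_F` -/

namespace StoneSpace

variable {B : Type*} [BooleanAlgebra B]

theorem continuous_toFun_apply (a : B) : Continuous fun p : StoneSpace B => toFun p a :=
  (continuous_apply a).comp continuous_induced_dom

/-- The indicator function of the clopen set given by an element of the Boolean algebra. -/
def indicator (a : B) : C(StoneSpace B, ℝ) where
  toFun p := if toFun p a then 1 else 0
  continuous_toFun :=
    (continuous_of_discreteTopology (f := fun b : Bool => if b then (1 : ℝ) else 0)).comp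
      (continuous_toFun_apply a)

theorem indicator_apply (a : B) (p : StoneSpace B) :
    indicator a p = if toFun p a then 1 else 0 := rfl

/-- Finitely many coordinates of a point are controlled by a single element of the algebra. -/
theorem exists_forall_toFun_eq (p : StoneSpace B) (I : Finset B) :
    ∃ c : B, toFun p c = true ∧
      ∀ q : StoneSpace B, toFun q c = true → ∀ a ∈ I, toFun q a = toFun p a := by
  classical
  have hinf : ∀ (q : StoneSpace B) (a b : B), toFun q (a ⊓ b) = (toFun q a && toFun q b) :=
    fun q a b => map_inf (show BoundedLatticeHom B Bool from q) a b
  have hcompl : ∀ (q : StoneSpace B) (a : B), toFun q aᶜ = !(toFun q a) :=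
    fun q a => map_compl' (show BoundedLatticeHom B Bool from q) a
  induction I using Finset.induction_on with
  | empty => exact ⟨⊤, map_top (show BoundedLatticeHom B Bool from p), by simp⟩
  | insert a I _ ih =>
    obtain ⟨c, hc, h⟩ := ih
    cases hp : toFun p a
    · refine ⟨c ⊓ aᶜ, by simp [hinf, hcompl, hc, hp], fun q hq b hb => ?_⟩
      simp only [hinf, hcompl, Bool.and_eq_true, Bool.not_eq_true'] at hq
      rcases Finset.mem_insert.1 hb with rfl | hb
      · rw [hq.2, hp]
      · exact h q hq.1 b hb
    · refine ⟨c ⊓ a, by simp [hinf, hc, hp], fun q hq b hb => ?_⟩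
      simp only [hinf, Bool.and_eq_true] at hq
      rcases Finset.mem_insert.1 hb with rfl | hb
      · rw [hq.2, hp]
      · exact h q hq.1 b hb

end StoneSpace

open Classical in
/-- The indicator function on `K_F` of a member of `adAlgebra F` (zero for other sets). -/
def ind (F : Set (Set ℕ)) (A : Set ℕ) : C(KSpace F, ℝ) :=
  if h : A ∈ adAlgebra F then StoneSpace.indicator ⟨A, h⟩ else 0

variable {F : Set (Set ℕ)}

theorem mem_adAlgebra {N : Set ℕ} (hN : N ∈ F) : N ∈ adAlgebra F :=
  BooleanSubalgebra.subset_closure (Or.inl hN)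

theorem mem_adAlgebra_of_finite {A : Set ℕ} (hA : A.Finite) : A ∈ adAlgebra F :=
  BooleanSubalgebra.subset_closure (Or.inr hA)

theorem toFun_natPoint (n : ℕ) (a : adAlgebra F) :
    StoneSpace.toFun (natPoint F n) a = true ↔ n ∈ (a : Set ℕ) :=
  StoneSpace.toFun_ofPred ..

theorem ind_natPoint {A : Set ℕ} (hA : A ∈ adAlgebra F) (n : ℕ) :
    ind F A (natPoint F n) = A.indicator 1 n := by
  classical
  simp [ind, hA, StoneSpace.indicator_apply, toFun_natPoint, Set.indicator_apply]

/-- Every neighbourhood of `p` contains all points sending some `c` with `p c = true` to `true`.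
Such a `c` is a nonempty set of integers, and any `n ∈ c` will do. -/
theorem denseRange_natPoint : DenseRange (natPoint F) := by
  classical
  intro p
  refine mem_closure_iff.2 fun O hO hpO => ?_
  obtain ⟨U, hU, rfl⟩ := isOpen_induced_iff.1 hO
  have hpU : p.toFun ∈ U := hpO
  obtain ⟨I, V, hV, hVU⟩ := isOpen_pi_iff.1 hU _ hpU
  obtain ⟨c, hc, h⟩ := p.exists_forall_toFun_eq I
  have hne : (c : Set ℕ).Nonempty := by
    rw [Set.nonempty_iff_ne_empty]
    intro he
    have : c = ⊥ := Subtype.ext he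
    rw [this, show StoneSpace.toFun p ⊥ = false from
      map_bot (show BoundedLatticeHom (adAlgebra F) Bool from p)] at hc
    exact Bool.false_ne_true hc
  obtain ⟨n, hn⟩ := hne
  refine ⟨natPoint F n, hVU fun a ha => ?_, n, rfl⟩
  rw [h _ ((toFun_natPoint n c).2 hn) a ha]
  exact (hV a ha).2

theorem ext_natPoint {x y : C(KSpace F, ℝ)}
    (h : ∀ n, x (natPoint F n) = y (natPoint F n)) : x = y :=
  DFunLike.coe_injective (denseRange_natPoint.equalizer x.continuous y.continuous (funext h))

theorem norm_le_of_natPoint {x : C(KSpace F, ℝ)} {c : ℝ} (hc : 0 ≤ c)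
    (h : ∀ n, |x (natPoint F n)| ≤ c) : ‖x‖ ≤ c :=
  (ContinuousMap.norm_le _ hc).2 fun t =>
    denseRange_natPoint.induction_on (p := fun t => ‖x t‖ ≤ c) t
      (isClosed_le x.continuous.norm continuous_const) h

theorem ind_mul {A B : Set ℕ} (hA : A ∈ adAlgebra F) (hB : B ∈ adAlgebra F) :
    ind F A * ind F B = ind F (A ∩ B) :=
  ext_natPoint fun n => by
    have hAB : A ∩ B ∈ adAlgebra F := (adAlgebra F).inf_mem hA hB
    by_cases h1 : n ∈ A <;> by_cases h2 : n ∈ B <;>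
      simp [ind_natPoint, hA, hB, hAB, h1, h2]

theorem ind_univ : ind F Set.univ = 1 :=
  ext_natPoint fun n => by
    rw [← Set.top_eq_univ, ind_natPoint (adAlgebra F).top_mem]
    simp

theorem ind_add_compl {A : Set ℕ} (hA : A ∈ adAlgebra F) : ind F A + ind F Aᶜ = 1 :=
  ext_natPoint fun n => by
    have hAB : Aᶜ ∈ adAlgebra F := (adAlgebra F).compl_mem hA
    by_cases h1 : n ∈ A <;> simp [ind_natPoint, hA, hAB, h1]

theorem ind_add_inter {A B : Set ℕ} (hA : A ∈ adAlgebra F) (hB : B ∈ adAlgebra F) :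
    ind F (A \ B) + ind F (A ∩ B) = ind F A :=
  ext_natPoint fun n => by
    have hAB : A ∩ B ∈ adAlgebra F := (adAlgebra F).inf_mem hA hB
    have hAB' : A \ B ∈ adAlgebra F := (adAlgebra F).sdiff_mem hA hB
    by_cases h1 : n ∈ A <;> by_cases h2 : n ∈ B <;>
      simp [ind_natPoint, hA, hAB', hAB, h1, h2]

theorem ind_finset (s : Finset ℕ) : ind F (s : Set ℕ) = ∑ k ∈ s, ind F {k} :=
  ext_natPoint fun n => by
    classical
    rw [ContinuousMap.sum_apply, ind_natPoint (mem_adAlgebra_of_finite s.finite_toSet)]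
    simp [ind_natPoint, mem_adAlgebra_of_finite, Set.indicator_apply]

/-- The functions `1`, `1_{k}` and `1_N` which generate `C(K_F)`. -/
def gens (F : Set (Set ℕ)) : Set C(KSpace F, ℝ) :=
  {1} ∪ (Set.range fun k : ℕ => ind F {k}) ∪ ind F '' F

/-- The span is closed under products because distinct members of `F` meet in a finite set;
complements and De Morgan then give all Boolean operations. -/
theorem ind_mem_span_gens (hF : IsAlmostDisjointFamily F) {A : Set ℕ} (hA : A ∈ adAlgebra F) :
    ind F A ∈ Submodule.span ℝ (gens F) := by
  set V := Submodule.span ℝ (gens F) with hV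
  have hone : (1 : C(KSpace F, ℝ)) ∈ V := Submodule.subset_span (Or.inl (Or.inl rfl))
  have hfin : ∀ s : Set ℕ, s.Finite → ind F s ∈ V := by
    intro s hs
    rw [← hs.coe_toFinset, ind_finset]
    exact Submodule.sum_mem _ fun k _ => Submodule.subset_span (Or.inl (Or.inr ⟨k, rfl⟩))
  have hgen : ∀ N ∈ F, ind F N ∈ V := fun N hN => Submodule.subset_span (Or.inr ⟨N, hN, rfl⟩)
  have hmul : ∀ x ∈ V, ∀ y ∈ V, x * y ∈ V := by
    have hVV : V * V ≤ V := by
      rw [hV, Submodule.span_mul_span, Submodule.span_le]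
      have hs : ∀ k, ({k} : Set ℕ) ∈ adAlgebra F := fun k =>
        mem_adAlgebra_of_finite (Set.finite_singleton k)
      rintro _ ⟨x, hx, y, hy, rfl⟩
      have hx' := Submodule.subset_span (R := ℝ) hx
      have hy' := Submodule.subset_span (R := ℝ) hy
      simp only [SetLike.mem_coe]
      rcases hx with (rfl | ⟨k, rfl⟩) | ⟨N, hN, rfl⟩
      · simpa using hy'
      · rcases hy with (rfl | ⟨l, rfl⟩) | ⟨M, hM, rfl⟩
        · simpa using hx'
        · simpa only [ind_mul (hs k) (hs l)] using
            hfin _ ((Set.finite_singleton k).inter_of_left _)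
        · simpa only [ind_mul (hs k) (mem_adAlgebra hM)] using
            hfin _ ((Set.finite_singleton k).inter_of_left _)
      · rcases hy with (rfl | ⟨l, rfl⟩) | ⟨M, hM, rfl⟩
        · simpa using hx'
        · simpa only [ind_mul (mem_adAlgebra hN) (hs l)] using
            hfin _ ((Set.finite_singleton l).inter_of_right _)
        · simp only [ind_mul (mem_adAlgebra hN) (mem_adAlgebra hM)]
          by_cases hNM : N = M
          · subst hNM
            simpa using hgen N hN
          · exact hfin _ (hF.2.2 hN hM hNM)
    exact fun x hx y hy => hVV (Submodule.mul_mem_mul hx hy)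
  have hcompl : ∀ A ∈ adAlgebra F, ind F A ∈ V → ind F Aᶜ ∈ V := by
    intro A hA h
    rw [← add_sub_cancel_left (ind F A) (ind F Aᶜ), ind_add_compl hA]
    exact V.sub_mem hone h
  refine BooleanSubalgebra.closure_bot_sup_induction (p := fun A _ => ind F A ∈ V)
    ?_ ?_ ?_ ?_ hA
  · rintro x (hx | hx)
    exacts [hgen x hx, hfin x hx]
  · exact hfin _ Set.finite_empty
  · intro A hA B hB h1 h2
    have hA' : A ∈ adAlgebra F := hA
    have hB' : B ∈ adAlgebra F := hB
    have hAc := (adAlgebra F).compl_mem hA'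
    have hBc := (adAlgebra F).compl_mem hB'
    have := hcompl _ ((adAlgebra F).inf_mem hAc hBc)
      (ind_mul hAc hBc ▸ hmul _ (hcompl A hA' h1) _ (hcompl B hB' h2))
    rwa [compl_inf, compl_compl, compl_compl] at this
  · exact fun A hA h => hcompl A hA h

/-- Stone–Weierstrass. The indicators are closed under multiplication, so the algebra they generate
is merely their linear span. -/
theorem dense_span_gens (hF : IsAlmostDisjointFamily F) :
    (Submodule.span ℝ (gens F)).topologicalClosure = ⊤ := by
  set S : Subalgebra ℝ C(KSpace F, ℝ) :=
    Algebra.adjoin ℝ (ind F '' (adAlgebra F : Set (Set ℕ))) with hS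
  have hsep : S.SeparatesPoints := by
    intro p q hpq
    obtain ⟨a, ha⟩ : ∃ a, StoneSpace.toFun p a ≠ StoneSpace.toFun q a := by
      by_contra! h
      exact hpq (StoneSpace.toFun_injective (funext h))
    refine ⟨_, ⟨ind F a, Algebra.subset_adjoin ⟨a, a.2, rfl⟩, rfl⟩, ?_⟩
    simp only [ind, SetLike.coe_mem, dif_pos, Subtype.coe_eta, StoneSpace.indicator_apply]
    cases hp : StoneSpace.toFun p a <;> cases hq : StoneSpace.toFun q a <;> simp_all
  have hle : Subalgebra.toSubmodule S ≤ Submodule.span ℝ (gens F) := by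
    rw [hS, Algebra.adjoin_eq_span, Submodule.span_le]
    intro x hx
    obtain ⟨A, hA, rfl⟩ : ∃ A ∈ adAlgebra F, ind F A = x := by
      induction hx using Submonoid.closure_induction with
      | mem x hx => exact hx
      | one => exact ⟨Set.univ, (adAlgebra F).top_mem, ind_univ⟩
      | mul x y _ _ h1 h2 =>
        obtain ⟨A, hA, rfl⟩ := h1
        obtain ⟨B, hB, rfl⟩ := h2
        exact ⟨A ∩ B, (adAlgebra F).inf_mem hA hB, (ind_mul hA hB).symm⟩
    exact ind_mem_span_gens hF hA
  have htop := ContinuousMap.subalgebra_topologicalClosure_eq_top_of_separatesPoints S hsep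
  rw [eq_top_iff]
  intro x _
  have hx : x ∈ S.topologicalClosure := htop ▸ Algebra.mem_top
  exact closure_mono (fun y hy => hle hy) hx

/-! ### Estimates for functionals -/

/-- Apply `f` to the sum of the indicators weighted by the signs of the values of `f`; by
disjointness it has norm at most 1. -/
theorem sum_abs_apply_ind_le (f : NormedDual C(KSpace F, ℝ)) {ι : Type*} (s : Finset ι)
    (A : ι → Set ℕ) (hA : ∀ i ∈ s, A i ∈ adAlgebra F)
    (hd : (s : Set ι).PairwiseDisjoint A) : ∑ i ∈ s, |f (ind F (A i))| ≤ ‖f‖ := by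
  set g : C(KSpace F, ℝ) := ∑ i ∈ s, (SignType.sign (f (ind F (A i))) : ℝ) • ind F (A i)
  have hfg : f g = ∑ i ∈ s, |f (ind F (A i))| := by
    simp only [g, map_sum, map_smul, smul_eq_mul]
    exact Finset.sum_congr rfl fun i _ => sign_mul_self _
  have hsign : ∀ t : ℝ, |((SignType.sign t : SignType) : ℝ)| ≤ 1 := by
    intro t
    rcases lt_trichotomy t 0 with h | h | h <;> simp [h]
  have hg : ‖g‖ ≤ 1 := by
    refine norm_le_of_natPoint zero_le_one fun n => ?_
    simp only [g, ContinuousMap.sum_apply, ContinuousMap.smul_apply, smul_eq_mul]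
    by_cases h : ∃ i ∈ s, n ∈ A i
    · obtain ⟨i, hi, hn⟩ := h
      rw [Finset.sum_eq_single_of_mem i hi, ind_natPoint (hA i hi)]
      · simpa [hn] using hsign _
      · intro j hj hji
        rw [ind_natPoint (hA j hj), Set.indicator_of_notMem, mul_zero]
        exact fun hnj => Set.disjoint_left.1 (hd hj hi hji) hnj hn
    · push Not at h
      rw [Finset.sum_eq_zero]
      · simp
      · intro i hi
        rw [ind_natPoint (hA i hi), Set.indicator_of_notMem (h i hi), mul_zero]
  rw [← hfg]
  calc f g ≤ ‖f g‖ := le_abs_self _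
    _ ≤ ‖f‖ * ‖g‖ := f.le_opNorm g
    _ ≤ ‖f‖ := mul_le_of_le_one_right (norm_nonneg f) hg

/-- Up to finitely many coordinates, the values of a functional on finitely many members of an
almost disjoint family are dominated by its norm. -/
theorem exists_sum_abs_apply_ind_le (hF : IsAlmostDisjointFamily F) (G : Finset (Set ℕ))
    (hG : (G : Set (Set ℕ)) ⊆ F) : ∃ E : Finset ℕ, ∀ f : NormedDual C(KSpace F, ℝ),
      ∑ N ∈ G, |f (ind F N)| ≤ ‖f‖ + G.card * ∑ k ∈ E, |f (ind F {k})| := by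
  classical
  have hfin : (⋃ N ∈ G, ⋃ M ∈ G.erase N, N ∩ M).Finite :=
    G.finite_toSet.biUnion fun N hN => (G.erase N).finite_toSet.biUnion fun M hM =>
      hF.2.2 (hG hN) (hG (Finset.mem_of_mem_erase hM)) (Finset.ne_of_mem_erase hM).symm
  -- `E` collects all pairwise intersections, so the sets `N \ E` are disjoint.
  refine ⟨hfin.toFinset, fun f => ?_⟩
  set E := hfin.toFinset with hE
  have hEm : (E : Set ℕ) ∈ adAlgebra F := mem_adAlgebra_of_finite E.finite_toSet
  have h1 : ∑ N ∈ G, |f (ind F (N \ E))| ≤ ‖f‖ := by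
    refine sum_abs_apply_ind_le f G (fun N => N \ E)
      (fun N hN => (adAlgebra F).sdiff_mem (mem_adAlgebra (hG hN)) hEm) ?_
    intro N hN M hM hNM
    refine Set.disjoint_left.2 fun n hn hm => hn.2 ?_
    rw [hE, hfin.coe_toFinset]
    exact Set.mem_biUnion hN (Set.mem_biUnion (Finset.mem_erase.2 ⟨hNM.symm, hM⟩) ⟨hn.1, hm.1⟩)
  have h2 : ∀ N ∈ G, |f (ind F N)| ≤ |f (ind F (N \ E))| + ∑ k ∈ E, |f (ind F {k})| := by
    intro N hN
    rw [← ind_add_inter (mem_adAlgebra (hG hN)) hEm, map_add]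
    refine (abs_add_le _ _).trans (add_le_add_right ?_ _)
    have : N ∩ E = ((E.filter (· ∈ N) : Finset ℕ) : Set ℕ) := by
      ext k
      simp [and_comm]
    rw [this, ind_finset, map_sum]
    refine (Finset.abs_sum_le_sum_abs _ _).trans ?_
    exact Finset.sum_le_sum_of_subset_of_nonneg (Finset.filter_subset _ _)
      fun _ _ _ => abs_nonneg _
  calc ∑ N ∈ G, |f (ind F N)|
      ≤ ∑ N ∈ G, (|f (ind F (N \ E))| + ∑ k ∈ E, |f (ind F {k})|) := Finset.sum_le_sum h2
    _ = ∑ N ∈ G, |f (ind F (N \ E))| + G.card * ∑ k ∈ E, |f (ind F {k})| := by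
        rw [Finset.sum_add_distrib, Finset.sum_const, nsmul_eq_mul]
    _ ≤ _ := add_le_add_left h1 _

/-! ### Sequential properties of the dual ball -/

theorem tendsto_toWeakDual_iff {X : Type*} [NormedAddCommGroup X] [NormedSpace ℝ X]
    {ι : Type*} {l : Filter ι} {u : ι → NormedDual X} {v : NormedDual X} :
    Tendsto (fun n => StrongDual.toWeakDual (u n)) l (𝓝 (StrongDual.toWeakDual v)) ↔
      ∀ x, Tendsto (fun n => u n x) l (𝓝 (v x)) :=
  tendsto_iff_forall_eval_tendsto_topDualPairing

theorem tendsto_apply_of_gens (hF : IsAlmostDisjointFamily F)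
    {u : ℕ → NormedDual C(KSpace F, ℝ)} {v : NormedDual C(KSpace F, ℝ)} {M : ℝ}
    (hM : ∀ n, ‖u n‖ ≤ M) (h : ∀ g ∈ gens F, Tendsto (fun n => u n g) atTop (𝓝 (v g)))
    (x : C(KSpace F, ℝ)) : Tendsto (fun n => u n x) atTop (𝓝 (v x)) := by
  have hspan : ∀ y ∈ Submodule.span ℝ (gens F), Tendsto (fun n => u n y) atTop (𝓝 (v y)) := by
    intro y hy
    induction hy using Submodule.span_induction with
    | mem y hy => exact h y hy
    | zero => simp
    | add y z _ _ h1 h2 => simpa using h1.add h2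
    | smul a y _ h1 => simpa using h1.const_mul a
  have hx : x ∈ closure (Submodule.span ℝ (gens F) : Set C(KSpace F, ℝ)) := by
    rw [← Submodule.topologicalClosure_coe, dense_span_gens hF]
    trivial
  have hM0 : 0 ≤ M := (norm_nonneg _).trans (hM 0)
  rw [Metric.tendsto_atTop]
  intro ε hε
  have hK : 0 < M + ‖v‖ + 1 := by positivity
  obtain ⟨y, hy, hxy⟩ := Metric.mem_closure_iff.1 hx (ε / 2 / (M + ‖v‖ + 1)) (by positivity)
  rw [lt_div_iff₀ hK, dist_eq_norm] at hxy
  obtain ⟨n₀, hn₀⟩ := Metric.tendsto_atTop.1 (hspan y hy) (ε / 2) (half_pos hε)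
  refine ⟨n₀, fun n hn => ?_⟩
  have h1 := hn₀ n hn
  rw [Real.dist_eq] at h1 ⊢
  have h2 : ‖u n (x - y)‖ ≤ M * ‖x - y‖ :=
    ((u n).le_opNorm _).trans (mul_le_mul_of_nonneg_right (hM n) (norm_nonneg _))
  have h3 : ‖v (x - y)‖ ≤ ‖v‖ * ‖x - y‖ := v.le_opNorm _
  have h4 : u n x - v x = u n (x - y) + (u n y - v y) - v (x - y) := by
    simp only [map_sub]; ring
  rw [Real.norm_eq_abs] at h2 h3
  rw [h4]
  have h5 := abs_sub (u n (x - y) + (u n y - v y)) (v (x - y))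
  have h6 := abs_add_le (u n (x - y)) (u n y - v y)
  nlinarith [norm_nonneg (x - y)]

/-- A bounded sequence of functionals has a weak-star cluster point, which takes the value
`lim u n x` at each point `x` where this limit exists. -/
theorem exists_forall_tendsto_apply_imp_eq {X : Type*} [NormedAddCommGroup X] [NormedSpace ℝ X]
    {u : ℕ → NormedDual X} {M : ℝ} (hM : ∀ n, ‖u n‖ ≤ M) :
    ∃ v : NormedDual X, ∀ x c, Tendsto (fun n => u n x) atTop (𝓝 c) → v x = c := by
  obtain ⟨v, -, hv⟩ :=
    (WeakDual.isCompact_closedBall (𝕜 := ℝ) (0 : StrongDual ℝ X) M).exists_mapClusterPt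
      (f := atTop) (u := fun n => StrongDual.toWeakDual (u n))
      (by simpa using Eventually.of_forall (f := atTop) hM)
  obtain ⟨w, rfl⟩ := StrongDual.toWeakDual.surjective v
  refine ⟨w, fun x c hc => ?_⟩
  have hcl : MapClusterPt (w x) atTop fun n => u n x :=
    hv.continuousAt_comp (f := fun w : WeakDual ℝ X => w x)
      (WeakDual.eval_continuous x).continuousAt
  have hne : (𝓝 (w x) ⊓ map (fun n => u n x) atTop).NeBot := hcl
  exact tendsto_nhds_unique (f := id) (tendsto_id.mono_left inf_le_left)
    ((tendsto_id.mono_left inf_le_right).trans hc)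

theorem exists_tendsto_of_gens (hF : IsAlmostDisjointFamily F)
    {u : ℕ → NormedDual C(KSpace F, ℝ)} {M : ℝ} (hM : ∀ n, ‖u n‖ ≤ M)
    (h : ∀ g ∈ gens F, ∃ c, Tendsto (fun n => u n g) atTop (𝓝 c)) :
    ∃ v : NormedDual C(KSpace F, ℝ), ∀ x, Tendsto (fun n => u n x) atTop (𝓝 (v x)) := by
  obtain ⟨v, hv⟩ := exists_forall_tendsto_apply_imp_eq hM
  refine ⟨v, tendsto_apply_of_gens hF hM fun g hg => ?_⟩
  obtain ⟨c, hc⟩ := h g hg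
  rwa [hv g c hc]

/-- A bounded sequence of functionals has a subsequence converging at countably many points. -/
theorem exists_subseq_tendsto_apply {X : Type*} [NormedAddCommGroup X] [NormedSpace ℝ X]
    {u : ℕ → NormedDual X} {M : ℝ} (hM : ∀ n, ‖u n‖ ≤ M) {D : Set X} (hD : D.Countable) :
    ∃ φ : ℕ → ℕ, StrictMono φ ∧ ∀ x ∈ D, ∃ c, Tendsto (fun n => u (φ n) x) atTop (𝓝 c) := by
  have : Countable D := hD.to_subtype
  have hc : IsCompact (Set.univ.pi fun x : D => Set.Icc (-(M * ‖(x : X)‖)) (M * ‖(x : X)‖)) :=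
    isCompact_univ_pi fun _ => isCompact_Icc
  obtain ⟨a, -, φ, hφ, ha⟩ := hc.tendsto_subseq (x := fun n (x : D) => u n x) fun n x _ => by
    rw [Set.mem_Icc, ← abs_le]
    exact ((u n).le_opNorm _).trans (mul_le_mul_of_nonneg_right (hM n) (norm_nonneg _))
  exact ⟨φ, hφ, fun x hx => ⟨a ⟨x, hx⟩, (tendsto_pi_nhds.1 ha) ⟨x, hx⟩⟩⟩

/-- The correction terms at single points vanish, so the values on the `1_N` are absolutely summable
and have countable support. -/
theorem countable_setOf_apply_ind_ne_zero (hF : IsAlmostDisjointFamily F)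
    (f : NormedDual C(KSpace F, ℝ)) (h0 : ∀ k : ℕ, f (ind F {k}) = 0) :
    {N | N ∈ F ∧ f (ind F N) ≠ 0}.Countable := by
  classical
  have hs : Summable fun N : F => |f (ind F (N : Set ℕ))| := by
    refine summable_of_sum_le (c := ‖f‖) (fun _ => abs_nonneg _) fun G => ?_
    obtain ⟨E, hE⟩ := exists_sum_abs_apply_ind_le hF (G.map (Function.Embedding.subtype _))
      (by intro N; simp only [Finset.coe_map, Set.mem_image]; rintro ⟨N, -, rfl⟩; exact N.2)
    simpa [h0] using hE f
  refine (hs.countable_support.image Subtype.val).mono ?_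
  rintro N ⟨hN, hne⟩
  exact ⟨⟨N, hN⟩, by simpa using hne, rfl⟩

/-- For a bounded sequence which is null on all `1_{k}` and `ε > 0`, every infinite set of indices
can be thinned out so that the values at all but finitely many `1_N` are eventually below `ε`. -/
theorem exists_infinite_subset_eventually_lt (hF : IsAlmostDisjointFamily F)
    {u : ℕ → NormedDual C(KSpace F, ℝ)} {M : ℝ} (hM : ∀ n, ‖u n‖ ≤ M)
    (h0 : ∀ k : ℕ, Tendsto (fun n => u n (ind F {k})) atTop (𝓝 0)) {ε : ℝ} (hε : 0 < ε)
    {A : Set ℕ} (hA : A.Infinite) : ∃ B ⊆ A, B.Infinite ∧ ∃ G : Finset (Set ℕ),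
      ∀ N ∈ F, N ∉ G → ∀ᶠ n in atTop, n ∈ B → |u n (ind F N)| < ε := by
  classical
  by_contra! hcon
  -- If thinning never succeeds, arbitrarily many `N` can be collected on which the values stay at
  -- least `ε` along a common infinite set of indices.
  have key : ∀ m : ℕ, ∃ B ⊆ A, B.Infinite ∧ ∃ G : Finset (Set ℕ), (G : Set (Set ℕ)) ⊆ F ∧
      G.card = m ∧ ∀ N ∈ G, ∀ n ∈ B, ε ≤ |u n (ind F N)| := by
    intro m
    induction m with
    | zero => exact ⟨A, subset_rfl, hA, ∅, by simp, rfl, by simp⟩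
    | succ m ih =>
      obtain ⟨B, hBA, hB, G, hGF, hGm, hG⟩ := ih
      obtain ⟨N, hN, hNG, hfr⟩ := hcon B hBA hB G
      refine ⟨{n | n ∈ B ∧ ε ≤ |u n (ind F N)|}, fun n hn => hBA hn.1,
        Nat.frequently_atTop_iff_infinite.1 hfr, insert N G, ?_, ?_, ?_⟩
      · simpa [Set.insert_subset_iff] using ⟨hN, hGF⟩
      · rw [Finset.card_insert_of_notMem hNG, hGm]
      · intro N' hN' n hn
        rcases Finset.mem_insert.1 hN' with rfl | hN'
        exacts [hn.2, hG N' hN' n hn.1]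
  -- With `m * ε > M + 1` the norm bound is violated; the summand 1 absorbs the correction term,
  -- which tends to 0.
  obtain ⟨m, hm⟩ := exists_nat_gt ((M + 1) / ε)
  obtain ⟨B, -, hB, G, hGF, hGm, hG⟩ := key m
  obtain ⟨E, hE⟩ := exists_sum_abs_apply_ind_le hF G hGF
  have hlim : Tendsto (fun n => (G.card : ℝ) * ∑ k ∈ E, |u n (ind F {k})|) atTop (𝓝 0) := by
    have : Tendsto (fun n => ∑ k ∈ E, |u n (ind F {k})|) atTop (𝓝 (∑ k ∈ E, |(0 : ℝ)|)) :=
      tendsto_finsetSum _ fun k _ => (h0 k).abs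
    simpa using this.const_mul (G.card : ℝ)
  obtain ⟨n, hn, hlt⟩ := ((Nat.frequently_atTop_iff_infinite.2 hB).and_eventually
    (hlim.eventually_lt_const one_pos)).exists
  have h1 : (m : ℝ) * ε ≤ ∑ N ∈ G, |u n (ind F N)| := by
    rw [← hGm, ← nsmul_eq_mul]
    exact Finset.card_nsmul_le_sum _ _ _ fun N hN => hG N hN n hn
  rw [div_lt_iff₀ hε] at hm
  linarith [hE (u n), hM n]

/-- The dual ball of `C(K_F)` is weak-star sequentially compact. -/
theorem exists_subseq_weakStar_tendsto (hF : IsAlmostDisjointFamily F)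
    {u : ℕ → NormedDual C(KSpace F, ℝ)} {M : ℝ} (hM : ∀ n, ‖u n‖ ≤ M) :
    ∃ φ : ℕ → ℕ, StrictMono φ ∧
      ∃ v : NormedDual C(KSpace F, ℝ), ∀ x, Tendsto (fun n => u (φ n) x) atTop (𝓝 (v x)) := by
  set D : Set C(KSpace F, ℝ) := {1} ∪ Set.range fun k : ℕ => ind F {k} with hD
  have hDc : D.Countable := (Set.countable_singleton _).union (Set.countable_range _)
  obtain ⟨φ, hφ, hcφ⟩ := exists_subseq_tendsto_apply hM hDc
  -- Subtracting a cluster point makes the sequence null on all `1_{k}`.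
  obtain ⟨v, hv⟩ := exists_forall_tendsto_apply_imp_eq fun n => hM (φ n)
  set w : ℕ → NormedDual C(KSpace F, ℝ) := fun n => u (φ n) - v with hw
  have hwM : ∀ n, ‖w n‖ ≤ M + ‖v‖ := fun n =>
    (norm_sub_le _ _).trans (add_le_add_left (hM _) _)
  have hw0 : ∀ k : ℕ, Tendsto (fun n => w n (ind F {k})) atTop (𝓝 0) := by
    intro k
    obtain ⟨c, hc⟩ := hcφ _ (Or.inr ⟨k, rfl⟩)
    simpa [hw, hv _ _ hc] using hc.sub_const c
  choose! B hBA hB G hG using fun (j : ℕ) (A : Set ℕ) (hA : A.Infinite) =>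
    exists_infinite_subset_eventually_lt hF hwM hw0 (Nat.one_div_pos_of_nat (α := ℝ) (n := j)) hA
  -- Successive thinning with `ε = 1 / (j + 1)`; the diagonal sequence `ψ` lies eventually in every
  -- `S j`.
  let S : ℕ → Set ℕ := fun j => Nat.rec Set.univ (fun i A => B i A) j
  have hS : ∀ j, (S j).Infinite := by
    intro j
    induction j with
    | zero => exact Set.infinite_univ
    | succ j ih => exact hB j _ ih
  have hanti : Antitone S := antitone_nat_of_succ_le fun j => hBA j _ (hS j)
  obtain ⟨ψ, hψ, hψS⟩ := extraction_forall_of_frequently fun j =>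
    Nat.frequently_atTop_iff_infinite.2 (hS j)
  -- Only countably many `N` were excepted; a further subsequence makes the values converge on
  -- these. On the others the diagonal sequence is already null.
  set D' : Set C(KSpace F, ℝ) := D ∪ ind F '' ⋃ j, (G j (S j) : Set (Set ℕ)) with hD'
  have hDc' : D'.Countable := hDc.union
    ((Set.countable_iUnion fun j => (G j (S j)).countable_toSet).image _)
  obtain ⟨θ, hθ, hcθ⟩ := exists_subseq_tendsto_apply (fun n => hM (φ (ψ n))) hDc'
  refine ⟨fun n => φ (ψ (θ n)), hφ.comp (hψ.comp hθ),
    exists_tendsto_of_gens hF (fun n => hM _) ?_⟩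
  rintro g (hg | ⟨N, hN, rfl⟩)
  · exact hcθ g (Or.inl hg)
  by_cases hNG : N ∈ ⋃ j, (G j (S j) : Set (Set ℕ))
  · exact hcθ _ (Or.inr ⟨N, hNG, rfl⟩)
  refine ⟨v (ind F N), ?_⟩
  suffices h : Tendsto (fun n => w (ψ n) (ind F N)) atTop (𝓝 0) by
    simpa [hw] using (h.comp hθ.tendsto_atTop).add_const (v (ind F N))
  rw [Metric.tendsto_nhds]
  intro ε hε
  obtain ⟨j, hj⟩ := exists_nat_one_div_lt hε
  have hNj : N ∉ G j (S j) := fun h => hNG (Set.mem_iUnion.2 ⟨j, h⟩)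
  filter_upwards [hψ.tendsto_atTop.eventually (hG j _ (hS j) N hN hNj),
    eventually_ge_atTop (j + 1)] with n hn hjn
  rw [Real.dist_eq, sub_zero]
  exact (hn (hanti hjn (hψS n))).trans hj

/-! ### Property (E') -/

theorem hasPropertyEPrime_of_isAlmostDisjointFamily (hF : IsAlmostDisjointFamily F) :
    HasPropertyEPrime C(KSpace F, ℝ) := by
  classical
  intro C _ hbdd hseq
  obtain ⟨M, hM⟩ := hbdd.exists_norm_le
  refine isClosed_of_closure_subset fun μ' hμ' => ?_
  obtain ⟨μ, rfl⟩ := StrongDual.toWeakDual.surjective μ'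
  have hlim : ∀ (u : ℕ → NormedDual C(KSpace F, ℝ)) (v : NormedDual C(KSpace F, ℝ)),
      (∀ n, u n ∈ C) → (∀ x, Tendsto (fun n => u n x) atTop (𝓝 (v x))) → v ∈ C := by
    intro u v hu huv
    obtain ⟨v', hv', h⟩ := hseq (fun n => ⟨u n, hu n, rfl⟩) (tendsto_toWeakDual_iff.2 huv)
    rwa [← StrongDual.toWeakDual.injective h]
  -- Restricted to a countable `D`, the weak-star topology is metrizable, so a sequence in `C`
  -- approximates `μ` on `D`; a weak-star convergent subsequence has its limit in `C`.
  have hcount : ∀ D : Set C(KSpace F, ℝ), D.Countable → ∃ v ∈ C, ∀ x ∈ D, v x = μ x := by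
    intro D hD
    obtain ⟨d, hd⟩ := (hD.insert 0).exists_eq_range (Set.insert_nonempty _ _)
    have hT : Continuous fun (w : WeakDual ℝ C(KSpace F, ℝ)) (i : ℕ) => w (d i) :=
      continuous_pi fun i => WeakDual.eval_continuous (d i)
    have hcl := image_closure_subset_closure_image hT (Set.mem_image_of_mem _ hμ')
    obtain ⟨y, hy, hyμ⟩ := mem_closure_iff_seq_limit.1 hcl
    simp only [Set.mem_image, exists_exists_and_eq_and] at hy
    choose u huC huy using hy
    obtain ⟨φ, hφ, v, hv⟩ := exists_subseq_weakStar_tendsto hF fun n => hM (u n) (huC n)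
    refine ⟨v, hlim _ v (fun n => huC (φ n)) hv, fun x hx => ?_⟩
    obtain ⟨i, rfl⟩ : x ∈ Set.range d := hd ▸ Or.inr hx
    refine tendsto_nhds_unique (hv (d i)) ?_
    have h := ((tendsto_pi_nhds.1 hyμ) i).comp hφ.tendsto_atTop
    simpa [← huy, Function.comp_def] using h
  choose! v hvC hv using hcount
  set D₀ : Set C(KSpace F, ℝ) := {1} ∪ Set.range fun k : ℕ => ind F {k}
  -- Closing off: at each stage add the countably many `1_N` on which the current approximant
  -- differs from `μ`. Each `1_N` is then either never a point of disagreement or a point of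
  -- agreement from some stage on.
  let D : ℕ → Set C(KSpace F, ℝ) := fun n => Nat.rec D₀
    (fun _ E => E ∪ ind F '' {N | N ∈ F ∧ (v E - μ) (ind F N) ≠ 0}) n
  have hD : ∀ n, D (n + 1) = D n ∪ ind F '' {N | N ∈ F ∧ (v (D n) - μ) (ind F N) ≠ 0} :=
    fun _ => rfl
  have hmono : Monotone D := monotone_nat_of_le_succ fun n => hD n ▸ Set.subset_union_left
  have hDc : ∀ n, (D n).Countable := by
    intro n
    induction n with
    | zero => exact (Set.countable_singleton _).union (Set.countable_range _)
    | succ n ih =>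
      refine ih.union (Set.Countable.image (countable_setOf_apply_ind_ne_zero hF _ ?_) _)
      intro k
      have hk : ind F {k} ∈ D n := hmono (Nat.zero_le n) (Or.inr ⟨k, rfl⟩)
      exact sub_eq_zero.2 (hv _ ih _ hk)
  refine ⟨μ, hlim (fun n => v (D n)) μ (fun n => hvC _ (hDc n)) ?_, rfl⟩
  refine tendsto_apply_of_gens hF (fun n => hM _ (hvC _ (hDc n))) ?_
  rintro g (hg | ⟨N, hN, rfl⟩)
  · exact tendsto_const_nhds.congr fun n => (hv _ (hDc n) g (hmono (Nat.zero_le n) hg)).symm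
  by_cases hall : ∀ n, (v (D n) - μ) (ind F N) = 0
  · exact tendsto_const_nhds.congr fun n => (sub_eq_zero.1 (hall n)).symm
  · push Not at hall
    obtain ⟨n, hn⟩ := hall
    refine tendsto_const_nhds.congr' ?_
    filter_upwards [eventually_gt_atTop n] with m hm
    exact (hv _ (hDc m) _ (hmono (Nat.succ_le_of_lt hm) (Or.inr ⟨N, ⟨hN, hn⟩, rfl⟩))).symm

/-! ### Construction of the almost disjoint family -/

/-- The two sums can differ only in terms outside `[p, q)`: the head before `p` and the tail from
`q`. -/
theorem tsum_indicator_sub_le {a : ℕ → ℝ} (ha : Summable fun k => |a k|) {A B : Set ℕ} {p q : ℕ}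
    (hpq : p ≤ q) (h : ∀ k, p ≤ k → k < q → (k ∈ A ↔ k ∈ B)) :
    |∑' k, A.indicator a k - ∑' k, B.indicator a k| ≤
      ∑ k ∈ Finset.range p, |a k| + ∑' k, |a (k + q)| := by
  have hA := ha.of_abs.indicator A
  have hB := ha.of_abs.indicator B
  set c : ℕ → ℝ := (Set.Ico p q)ᶜ.indicator fun k => |a k| with hc
  have hcs : Summable c := ha.indicator _
  have hle : ∀ k, |A.indicator a k - B.indicator a k| ≤ c k := by
    intro k
    by_cases hk : k ∈ Set.Ico p q
    · have := h k hk.1 hk.2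
      by_cases hkA : k ∈ A
      · simp [hc, hk, hkA, this.1 hkA]
      · simp [hc, hk, hkA, mt this.2 hkA]
    · by_cases hkA : k ∈ A <;> by_cases hkB : k ∈ B <;>
        simp [hc, Set.indicator_of_mem (Set.mem_compl hk), hkA, hkB]
  rw [← hA.tsum_sub hB]
  calc |∑' k, (A.indicator a k - B.indicator a k)| ≤ ∑' k, c k := by
        exact tsum_of_norm_bounded (f := fun k => A.indicator a k - B.indicator a k)
          hcs.hasSum hle
    _ = ∑ k ∈ Finset.range q, c k + ∑' k, c (k + q) := (hcs.sum_add_tsum_nat_add q).symm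
    _ = _ := by
      congr 1
      · rw [← Finset.sum_range_add_sum_Ico _ hpq, add_eq_left.2]
        · exact Finset.sum_congr rfl fun k hk => by
            have : k < p := Finset.mem_range.1 hk
            exact Set.indicator_of_mem (fun h => absurd h.1 (by omega)) _
        · exact Finset.sum_eq_zero fun k hk => by
            have := Finset.mem_Ico.1 hk
            exact Set.indicator_of_notMem (fun h : k ∉ Set.Ico p q => h this) _
      · exact tsum_congr fun k => Set.indicator_of_mem (fun h => absurd h.2 (by omega)) _

/-- A sequence in `ℓ₁` which, on a countable almost disjoint family `G`, looks as if it converged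
to `δ_∞`, can be prevented from doing so by adding one set to `G`. -/
theorem exists_infinite_almostDisjoint_not_tendsto {G : Set (Set ℕ)} (hGc : G.Countable)
    (hGne : G.Nonempty) (hGd : G.Pairwise fun M N => (M ∩ N).Finite) {x : ℕ → ℕ → ℝ}
    (hs : ∀ n, Summable fun k => |x n k|) (h0 : ∀ k, Tendsto (fun n => x n k) atTop (𝓝 0))
    (h1 : Tendsto (fun n => ∑' k, x n k) atTop (𝓝 1))
    (hG : ∀ N ∈ G, Tendsto (fun n => ∑' k, N.indicator (x n) k) atTop (𝓝 0)) :
    ∃ A : Set ℕ, A.Infinite ∧ (∀ N ∈ G, (A ∩ N).Finite) ∧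
      ¬ Tendsto (fun n => ∑' k, A.indicator (x n) k) atTop (𝓝 0) := by
  classical
  have hsi : ∀ n (A : Set ℕ), Summable (A.indicator (x n)) := fun n A =>
    (hs n).of_abs.indicator A
  have hfin : ∀ A : Set ℕ, A.Finite →
      Tendsto (fun n => ∑' k, A.indicator (x n) k) atTop (𝓝 0) := by
    intro A hA
    have : ∀ n, ∑' k, A.indicator (x n) k = ∑ k ∈ hA.toFinset, x n k := by
      intro n
      rw [tsum_eq_sum (s := hA.toFinset) fun k hk => Set.indicator_of_notMem (by simpa using hk) _]
      exact Finset.sum_congr rfl fun k hk => Set.indicator_of_mem (by simpa using hk) _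
    simp only [this]
    simpa using tendsto_finsetSum hA.toFinset fun k _ => h0 k
  have hunion : ∀ A B : Set ℕ, (A ∩ B).Finite →
      Tendsto (fun n => ∑' k, A.indicator (x n) k) atTop (𝓝 0) →
      Tendsto (fun n => ∑' k, B.indicator (x n) k) atTop (𝓝 0) →
      Tendsto (fun n => ∑' k, (A ∪ B).indicator (x n) k) atTop (𝓝 0) := by
    intro A B hAB hA hB
    have h := (hA.add hB).sub (hfin _ hAB)
    simp only [add_zero, sub_zero] at h
    refine h.congr fun n => ?_
    rw [← (hsi n A).tsum_add (hsi n B), ← ((hsi n A).add (hsi n B)).tsum_sub (hsi n _)]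
    refine tsum_congr fun k => ?_
    rw [← Set.indicator_union_add_inter_apply]
    ring
  have hsmall : ∀ s : Finset (Set ℕ), (s : Set (Set ℕ)) ⊆ G →
      Tendsto (fun n => ∑' k, (⋃₀ (s : Set (Set ℕ))).indicator (x n) k) atTop (𝓝 0) := by
    intro s
    induction s using Finset.induction_on with
    | empty => intro _; simp
    | insert N s hN ih =>
      intro h
      rw [Finset.coe_insert, Set.insert_subset_iff] at h
      rw [Finset.coe_insert, Set.sUnion_insert]
      refine hunion _ _ ?_ (hG N h.1) (ih h.2)
      rw [Set.sUnion_eq_biUnion, Set.inter_iUnion₂]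
      exact s.finite_toSet.biUnion fun M hM => hGd h.1 (h.2 hM) fun e => hN (e ▸ hM)
  obtain ⟨g, rfl⟩ := hGc.exists_eq_range hGne
  -- One hump: off the first `j` sets the mass of `x n` exceeds 3/4, while the head before `p` and
  -- the tail from `q` each weigh less than 1/8. Whatever happens outside `[p, q)`, more than 3/4 -
  -- 1/8 - 1/8 = 1/2 remains.
  have step : ∀ j p : ℕ, ∃ q n : ℕ, p < q ∧ p ≤ n ∧ ∃ B : Finset ℕ, B.Nonempty ∧
      (∀ k ∈ B, p ≤ k ∧ k < q ∧ ∀ i < j, k ∉ g i) ∧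
      ∀ A : Set ℕ, (∀ k, p ≤ k → k < q → (k ∈ A ↔ k ∈ B)) →
        1 / 2 < ∑' k, A.indicator (x n) k := by
    intro j p
    set U : Set ℕ := ⋃₀ (((Finset.range j).image g : Finset (Set ℕ)) : Set (Set ℕ)) with hU
    have hUlim := hsmall ((Finset.range j).image g) (by
      intro N hN
      obtain ⟨i, -, rfl⟩ := Finset.mem_image.1 (Finset.mem_coe.1 hN)
      exact ⟨i, rfl⟩)
    have hlim : Tendsto (fun n => ∑' k, Uᶜ.indicator (x n) k) atTop (𝓝 1) := by
      have h := h1.sub hUlim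
      rw [sub_zero] at h
      refine h.congr fun n => ?_
      rw [← (hs n).of_abs.tsum_sub (hsi n _)]
      exact tsum_congr fun k => by rw [Set.indicator_compl]; rfl
    have hlim' : Tendsto (fun n => ∑ k ∈ Finset.range p, |x n k|) atTop (𝓝 0) := by
      simpa using tendsto_finsetSum (Finset.range p) fun k _ => (h0 k).abs
    obtain ⟨n, ⟨hn1, hn2⟩, hpn⟩ := (((hlim.eventually_const_lt
      (show (3 / 4 : ℝ) < 1 by norm_num)).and (hlim'.eventually_lt_const
      (show (0 : ℝ) < 1 / 8 by norm_num))).and (eventually_ge_atTop p)).exists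
    obtain ⟨q, hq, hpq⟩ := (((tendsto_sum_nat_add fun k => |x n k|).eventually_lt_const
      (show (0 : ℝ) < 1 / 8 by norm_num)).and (eventually_gt_atTop p)).exists
    have hA : ∀ A : Set ℕ, (∀ k, p ≤ k → k < q → (k ∈ A ↔ k ∈ (Finset.Ico p q).filter (· ∉ U))) →
        1 / 2 < ∑' k, A.indicator (x n) k := by
      intro A hA
      have h := tsum_indicator_sub_le (hs n) hpq.le (A := A) (B := Uᶜ) fun k h1 h2 => by
        rw [hA k h1 h2]
        simp [h1, h2]
      linarith [(abs_le.1 h).1]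
    refine ⟨q, n, hpq, hpn, (Finset.Ico p q).filter (· ∉ U), ?_, ?_, hA⟩
    · by_contra hne
      rw [Finset.not_nonempty_iff_eq_empty] at hne
      have h := hA ∅ fun k _ _ => by simp [hne]
      simp at h
      linarith
    · intro k hk
      obtain ⟨hk1, hk2⟩ := Finset.mem_filter.1 hk
      obtain ⟨hk3, hk4⟩ := Finset.mem_Ico.1 hk1
      refine ⟨hk3, hk4, fun i hi hki => hk2 ⟨g i, ?_, hki⟩⟩
      exact Finset.mem_coe.2 (Finset.mem_image_of_mem g (Finset.mem_range.2 hi))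
  choose q n hpq hpn B hBne hB hBA using step
  -- The humps are placed in consecutive intervals `[p j, p (j + 1))`, so they do not interfere.
  -- Only humps with `j ≤ i` can meet `g i`.
  let p : ℕ → ℕ := fun j => Nat.rec 0 (fun i r => q i r) j
  have hp : StrictMono p := strictMono_nat_of_lt_succ fun j => hpq j (p j)
  have hmem : ∀ j k, p j ≤ k → k < q j (p j) → (k ∈ ⋃ i, (B i (p i) : Set ℕ) ↔ k ∈ B j (p j)) := by
    intro j k h1 h2
    refine ⟨fun h => ?_, fun h => Set.mem_iUnion.2 ⟨j, h⟩⟩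
    obtain ⟨i, hi⟩ := Set.mem_iUnion.1 h
    have hi' := hB i (p i) k hi
    have h3 : i < j + 1 := hp.lt_iff_lt.1 (hi'.1.trans_lt h2)
    have h4 : j < i + 1 := hp.lt_iff_lt.1 (h1.trans_lt hi'.2.1)
    obtain rfl : i = j := by omega
    exact hi
  refine ⟨⋃ i, (B i (p i) : Set ℕ), ?_, ?_, ?_⟩
  · refine Set.infinite_of_not_bddAbove ?_
    rintro ⟨b, hb⟩
    obtain ⟨k, hk⟩ := hBne (b + 1) (p (b + 1))
    have h2 := (hB _ _ k hk).1
    have h3 := hp.id_le (b + 1)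
    have h4 := hb (Set.mem_iUnion.2 ⟨b + 1, hk⟩)
    simp only [id] at h3
    omega
  · rintro _ ⟨i, rfl⟩
    refine ((Set.finite_Iic i).biUnion fun j _ => (B j (p j)).finite_toSet).subset ?_
    rintro k ⟨hk, hki⟩
    obtain ⟨j, hj⟩ := Set.mem_iUnion.1 hk
    refine Set.mem_biUnion (?_ : j ≤ i) hj
    by_contra! hij
    exact (hB j _ k hj).2.2 i hij hki
  · intro h
    obtain ⟨m, hm⟩ := eventually_atTop.1 (h.eventually_lt_const (show (0 : ℝ) < 1 / 2 by norm_num))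
    exact lt_asymm (hm (n m (p m)) ((hp.id_le m).trans (hpn m _)))
      (hBA m (p m) _ (hmem m))

/-- No absolutely summable sequences converge, on the generators of `C(K_F)`, to `δ_∞`. -/
def AvoidsInfty (F : Set (Set ℕ)) : Prop :=
  ∀ x : ℕ → ℕ → ℝ, (∀ n, Summable fun k => |x n k|) →
    (∀ k, Tendsto (fun n => x n k) atTop (𝓝 0)) → Tendsto (fun n => ∑' k, x n k) atTop (𝓝 1) →
    ∃ N ∈ F, ¬ Tendsto (fun n => ∑' k, N.indicator (x n) k) atTop (𝓝 0)

theorem AvoidsInfty.mono {F F' : Set (Set ℕ)} (h : AvoidsInfty F) (hF : F ⊆ F') :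
    AvoidsInfty F' := fun x h1 h2 h3 =>
  let ⟨N, hN, h4⟩ := h x h1 h2 h3
  ⟨N, hF hN, h4⟩

theorem exists_countable_isAlmostDisjointFamily :
    ∃ F : Set (Set ℕ), F.Countable ∧ IsAlmostDisjointFamily F := by
  let A : ℕ → Set ℕ := fun i => {n | n.unpair.1 = i}
  have hinf : ∀ i, (A i).Infinite := fun i =>
    Set.infinite_of_injective_forall_mem (f := fun j => Nat.pair i j)
      (fun j k h => (Nat.pair_eq_pair.1 h).2) (fun j => by simp [A])
  have hinj : Function.Injective A := by
    intro i j h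
    have : Nat.pair i 0 ∈ A j := h ▸ (show Nat.pair i 0 ∈ A i by simp [A])
    simpa [A] using this
  refine ⟨Set.range A, Set.countable_range A, Set.infinite_range_of_injective hinj, ?_, ?_⟩
  · rintro _ ⟨i, rfl⟩
    exact hinf i
  · rintro _ ⟨i, rfl⟩ _ ⟨j, rfl⟩ hij
    have : A i ∩ A j = ∅ := by
      ext n
      simp only [A, Set.mem_inter_iff, Set.mem_ofPred_eq, Set.mem_empty_iff_false, iff_false]
      rintro ⟨rfl, h⟩
      exact hij (by rw [h])
    rw [this]
    exact Set.finite_empty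

/-- Transfinite recursion of length `ω₁`: stage `t` deals with the sequence `e t`, and initial
segments are countable, as the gliding hump requires. -/
theorem exists_isAlmostDisjointFamily_avoidsInfty (CH : Cardinal.continuum.{0} = Cardinal.aleph 1) :
    ∃ F : Set (Set ℕ), IsAlmostDisjointFamily F ∧ AvoidsInfty F := by
  classical
  obtain ⟨F₀, hF₀c, hF₀⟩ := exists_countable_isAlmostDisjointFamily
  obtain ⟨N₀, hN₀⟩ := hF₀.1.nonempty
  let T := (Cardinal.aleph.{0} 1).ord.ToType
  have hseg : ∀ t : T, (Set.Iio t).Countable := by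
    intro t
    have h : Cardinal.mk (Set.Iio t) < Cardinal.mk T := Cardinal.mk_Iio_lt t (by simp [T])
    rw [show Cardinal.mk T = Order.succ Cardinal.aleph0 by simp [T], Order.lt_succ_iff] at h
    exact Cardinal.le_aleph0_iff_set_countable.1 h
  -- CH: there are as many stages as double sequences of reals.
  obtain ⟨e⟩ : Nonempty (T ≃ (ℕ → ℕ → ℝ)) := by
    rw [← Cardinal.eq]
    simp [T, ← CH, Cardinal.mk_real]
  let Good : Set (Set ℕ) → T → Set ℕ → Prop := fun G t A =>
    A.Infinite ∧ (∀ N ∈ G, (A ∩ N).Finite) ∧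
      ¬ Tendsto (fun n => ∑' k, A.indicator (e t n) k) atTop (𝓝 0)
  -- The default `N₀` already lies in `F₀`, so a stage with nothing to do adds no new set.
  let pick : Set (Set ℕ) → T → Set ℕ := fun G t => if h : ∃ A, Good G t A then h.choose else N₀
  let N : T → Set ℕ := WellFounded.fix (wellFounded_lt (α := T)) fun t ih =>
    pick (F₀ ∪ Set.range fun s : Set.Iio t => ih s.1 s.2) t
  let G : T → Set (Set ℕ) := fun t => F₀ ∪ N '' Set.Iio t
  have hN : ∀ t, N t = pick (G t) t := by
    intro t
    have h := WellFounded.fix_eq (wellFounded_lt (α := T)) (fun t ih =>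
      pick (F₀ ∪ Set.range fun s : Set.Iio t => ih s.1 s.2) t) t
    simp only [G, Set.image_eq_range]
    exact h
  have hdich : ∀ t, Good (G t) t (N t) ∨ (N t = N₀ ∧ ¬ ∃ A, Good (G t) t A) := by
    intro t
    rw [hN]
    by_cases h : ∃ A, Good (G t) t A
    · simp only [pick, dif_pos h]
      exact Or.inl h.choose_spec
    · simp only [pick, dif_neg h]
      exact Or.inr ⟨trivial, h⟩
  have hF : IsAlmostDisjointFamily (F₀ ∪ Set.range N) := by
    have hsymm : ∀ {A B : Set ℕ}, (A ∩ B).Finite → (B ∩ A).Finite := fun h =>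
      Set.inter_comm _ _ ▸ h
    have h0 : ∀ t, ∀ M ∈ F₀, N t ≠ M → (N t ∩ M).Finite := by
      intro t M hM hne
      rcases hdich t with h | ⟨h, -⟩
      · exact h.2.1 M (Or.inl hM)
      · rw [h] at hne ⊢
        exact hF₀.2.2 hN₀ hM hne
    have hlt : ∀ s t, s < t → N t ≠ N s → (N t ∩ N s).Finite := by
      intro s t hst hne
      rcases hdich t with h | ⟨h, -⟩
      · exact h.2.1 _ (Or.inr ⟨s, hst, rfl⟩)
      · rw [h] at hne ⊢
        exact hsymm (h0 s N₀ hN₀ hne.symm)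
    refine ⟨hF₀.1.mono Set.subset_union_left, ?_, ?_⟩
    · rintro A (hA | ⟨t, rfl⟩)
      · exact hF₀.2.1 A hA
      · rcases hdich t with h | ⟨h, -⟩
        · exact h.1
        · exact h ▸ hF₀.2.1 _ hN₀
    · rintro A (hA | ⟨t, rfl⟩) B (hB | ⟨s, rfl⟩) hAB
      · exact hF₀.2.2 hA hB hAB
      · exact hsymm (h0 s A hA hAB.symm)
      · exact h0 t B hB hAB
      · rcases lt_trichotomy s t with h | rfl | h
        · exact hlt s t h hAB
        · exact absurd rfl hAB
        · exact hsymm (hlt t s h hAB.symm)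
  refine ⟨_, hF, fun x hs h0 h1 => ?_⟩
  by_contra! hcon
  obtain ⟨t, rfl⟩ := e.surjective x
  have hGF : G t ⊆ F₀ ∪ Set.range N :=
    Set.union_subset_union_right _ (Set.image_subset_range _ _)
  have hgood : ∃ A, Good (G t) t A :=
    exists_infinite_almostDisjoint_not_tendsto (hF₀c.union ((hseg t).image N))
      ⟨N₀, Or.inl hN₀⟩ (hF.2.2.mono hGF) hs h0 h1 fun M hM => hcon M (hGF hM)
  rcases hdich t with h | ⟨-, h⟩
  · exact h.2.2 (hcon _ (Or.inr ⟨t, rfl⟩))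
  · exact h hgood

theorem IsAlmostDisjointFamily.exists_maximal {F : Set (Set ℕ)} (hF : IsAlmostDisjointFamily F) :
    ∃ F', F ⊆ F' ∧ IsMaximalAlmostDisjointFamily F' := by
  refine zorn_subset_nonempty {F | IsAlmostDisjointFamily F} (fun c hc hchain hne => ?_) F hF
  obtain ⟨G, hG⟩ := hne
  refine ⟨⋃₀ c, ⟨(hc hG).1.mono (Set.subset_sUnion_of_mem hG), ?_, ?_⟩,
    fun s hs => Set.subset_sUnion_of_mem hs⟩
  · rintro N ⟨H, hH, hN⟩
    exact (hc hH).2.1 N hN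
  · rw [Set.pairwise_sUnion hchain.directedOn]
    exact fun H hH => (hc hH).2.2

/-! ### Incompleteness of a Mackey topology -/

/-- A linear functional on the dual which is weak-star continuous on an absolutely convex
weak-star compact set is there a uniform limit of evaluations. -/
theorem exists_forall_abs_sub_apply_lt {X : Type*} [NormedAddCommGroup X] [NormedSpace ℝ X]
    {K : Set (WeakDual ℝ X)} (hKc : AbsConvex ℝ K) (hK : IsCompact K) (φ : WeakDual ℝ X →ₗ[ℝ] ℝ)
    (hφ : ContinuousOn φ K) {ε : ℝ} (hε : 0 < ε) : ∃ x : X, ∀ f ∈ K, |f x - φ f| < ε := by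
  rcases K.eq_empty_or_nonempty with rfl | hne
  · exact ⟨0, by simp⟩
  have : LocallyConvexSpace ℝ (WeakDual ℝ X) :=
    inferInstanceAs (LocallyConvexSpace ℝ (WeakBilin (topDualPairing ℝ X)))
  have h0 : (0 : WeakDual ℝ X) ∈ K := hKc.1.zero_mem hne
  have hconv : ∀ c : ℝ, Convex ℝ ((fun f => (f, φ f + c)) '' K) := by
    rintro c _ ⟨f, hf, rfl⟩ _ ⟨g, hg, rfl⟩ a b ha hb hab
    refine ⟨a • f + b • g, hKc.2 hf hg ha hb hab, ?_⟩
    refine Prod.ext rfl ?_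
    simp only [map_add, map_smul, Prod.snd_add, Prod.smul_mk, smul_eq_mul]
    linear_combination (-c) * hab
  have hcomp : ∀ c : ℝ, IsCompact ((fun f => (f, φ f + c)) '' K) := fun c =>
    hK.image_of_continuousOn (continuousOn_id.prodMk (hφ.add continuousOn_const))
  -- Separate the graph of `φ` over `K` from its translate by `ε`. Since the dual of the weak-star
  -- topology is `X`, the separating functional is `(f, r) ↦ f x + r * L (0, 1)`.
  obtain ⟨L, u, v, h1, h2, h3⟩ := geometric_hahn_banach_compact_closed (hconv 0) (hcomp 0)
    (hconv ε) (hcomp ε).isClosed (by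
      refine Set.disjoint_left.2 ?_
      rintro _ ⟨f, -, rfl⟩ ⟨g, -, h⟩
      have ha := congrArg Prod.fst h
      have hb := congrArg Prod.snd h
      simp only at ha hb
      subst ha
      linarith)
  have hL : ∀ f r, L (f, r) = L (f, 0) + r * L (0, 1) := by
    intro f r
    rw [← smul_eq_mul, ← map_smul, ← map_add]
    simp
  obtain ⟨x, hx⟩ := LinearMap.dualEmbedding_surjective (topDualPairing ℝ X)
    (L.comp (ContinuousLinearMap.inl ℝ (WeakDual ℝ X) ℝ))
  have hx' : ∀ f : WeakDual ℝ X, L (f, 0) = f x := fun f => (DFunLike.congr_fun hx f).symm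
  have hlt : ∀ f ∈ K, f x + φ f * L (0, 1) < ε * L (0, 1) := by
    intro f hf
    have ha := h1 _ ⟨f, hf, rfl⟩
    have hb := h3 _ ⟨0, h0, rfl⟩
    rw [hL, hx'] at ha hb
    simp only [map_zero, add_zero, zero_add] at ha hb
    have : (0 : WeakDual ℝ X) x = 0 := rfl
    linarith
  have hpos : 0 < L (0, 1) := by
    have h := hlt 0 h0
    have h' : (0 : WeakDual ℝ X) x = 0 := rfl
    rw [h', map_zero, zero_mul, add_zero] at h
    exact pos_of_mul_pos_right h hε.le
  refine ⟨-(L (0, 1))⁻¹ • x, fun f hf => ?_⟩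
  have ha := hlt f hf
  -- Symmetry of `K` turns the one-sided estimate into a two-sided one.
  have hb := hlt (-f) (hKc.1.neg_mem_iff.2 hf)
  have h' : (-f : WeakDual ℝ X) x = -f x := rfl
  rw [h', map_neg] at hb
  rw [map_smul, smul_eq_mul, abs_lt]
  have hc : f x = L (0, 1) * ((L (0, 1))⁻¹ * f x) := by field_simp
  set r := (L (0, 1))⁻¹ * f x
  rw [hc] at ha hb
  constructor <;> nlinarith

/-- Nonempty `K` and `L` contain 0, so `K + L` contains both. -/
theorem directedOn_absConvexWeakStarCompacts {X : Type*} [NormedAddCommGroup X] [NormedSpace ℝ X]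
    (Y : Submodule ℝ (NormedDual X)) :
    DirectedOn (· ⊆ ·) (absConvexWeakStarCompacts Y) := by
  intro K hK L hL
  rcases K.eq_empty_or_nonempty with rfl | hKn
  · exact ⟨L, hL, Set.empty_subset _, subset_rfl⟩
  rcases L.eq_empty_or_nonempty with rfl | hLn
  · exact ⟨K, hK, subset_rfl, Set.empty_subset _⟩
  open Pointwise in
  refine ⟨K + L, ⟨?_, ⟨hK.2.1.1.add hL.2.1.1, hK.2.1.2.add hL.2.1.2⟩, hK.2.2.add hL.2.2⟩, ?_, ?_⟩
  · rintro _ ⟨f, hf, g, hg, rfl⟩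
    exact Y.add_mem (hK.1 f hf) (hL.1 g hg)
  · exact fun f hf => ⟨f, hf, 0, hL.2.1.1.zero_mem hLn, add_zero f⟩
  · exact fun f hf => ⟨0, hK.2.1.1.zero_mem hKn, f, hf, zero_add f⟩

/-- If `μ(X, Y)` is complete, then every linear functional which is weak-star continuous on the
absolutely convex weak-star compact subsets of `Y` is an evaluation on `Y`. -/
theorem exists_forall_apply_eq_of_completeSpace {X : Type*} [NormedAddCommGroup X]
    [NormedSpace ℝ X] (Y : Submodule ℝ (NormedDual X))
    (hY : @CompleteSpace X (mackeyUniformSpace Y)) (φ : WeakDual ℝ X →ₗ[ℝ] ℝ)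
    (hφ : ∀ K ∈ absConvexWeakStarCompacts Y, ContinuousOn φ K) :
    ∃ x : X, ∀ K ∈ absConvexWeakStarCompacts Y, ∀ f ∈ K, f x = φ f := by
  set 𝔖 := absConvexWeakStarCompacts Y
  let J : X → UniformOnFun (WeakDual ℝ X) ℝ 𝔖 := fun x =>
    UniformOnFun.ofFun 𝔖 fun f : WeakDual ℝ X => f x
  let Φ : UniformOnFun (WeakDual ℝ X) ℝ 𝔖 := UniformOnFun.ofFun 𝔖 φ
  have hne : 𝔖.Nonempty := ⟨∅, by simp, ⟨by simp [Balanced], convex_empty⟩, isCompact_empty⟩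
  -- The filter of those `x` whose evaluations approach `φ` uniformly on members of `𝔖` is proper by
  -- the approximation lemma, and Cauchy as a pullback of `𝓝 Φ`.
  have hbot : (comap J (𝓝 Φ)).NeBot := by
    refine ((UniformOnFun.hasBasis_nhds_of_basis _ _ 𝔖 Φ hne
      (directedOn_absConvexWeakStarCompacts Y) Metric.uniformity_basis_dist).comap J).neBot_iff.2 ?_
    rintro ⟨K, ε⟩ ⟨hK, hε⟩
    obtain ⟨x, hx⟩ := exists_forall_abs_sub_apply_lt hK.2.1 hK.2.2 φ (hφ K hK) hε
    exact ⟨x, fun f hf => hx f hf⟩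
  let := mackeyUniformSpace Y
  have hcauchy : Cauchy (comap J (𝓝 Φ)) := cauchy_nhds.comap' le_rfl hbot
  obtain ⟨x, hx⟩ := CompleteSpace.complete hcauchy
  have hJ : Tendsto J (comap J (𝓝 Φ)) (𝓝 (J x)) :=
    (uniformContinuous_comap.continuous.tendsto x).mono_left hx
  refine ⟨x, fun K hK f hf => ?_⟩
  have hev := (UniformOnFun.uniformContinuous_eval_of_mem ℝ 𝔖 hf hK).continuous
  exact tendsto_nhds_unique ((hev.tendsto (J x)).comp hJ)
    ((hev.tendsto Φ).comp tendsto_comap)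

/-! ### The subspace `ℓ₁(ℕ) ⊕ ℝ δ_∞` and its coefficient functional -/

theorem diracFunctional_apply {K : Type*} [TopologicalSpace K] [CompactSpace K] (t : K)
    (x : C(K, ℝ)) : diracFunctional t x = x t := rfl

theorem norm_diracFunctional_le {K : Type*} [TopologicalSpace K] [CompactSpace K] (t : K) :
    ‖diracFunctional t‖ ≤ 1 :=
  ContinuousLinearMap.opNorm_le_bound _ zero_le_one fun x => by
    simpa [diracFunctional_apply] using x.norm_coe_le_norm t

theorem summable_abs_apply_ind_singleton (f : NormedDual C(KSpace F, ℝ)) :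
    Summable fun k : ℕ => |f (ind F {k})| :=
  summable_of_sum_le (fun _ => abs_nonneg _) fun s =>
    sum_abs_apply_ind_le f s (fun k : ℕ => ({k} : Set ℕ))
      (fun k _ => mem_adAlgebra_of_finite (Set.finite_singleton k))
      fun _ _ _ _ hkl => Set.disjoint_singleton.2 hkl

theorem tsum_abs_apply_ind_singleton_le (f : NormedDual C(KSpace F, ℝ)) :
    ∑' k : ℕ, |f (ind F {k})| ≤ ‖f‖ :=
  (summable_abs_apply_ind_singleton f).tsum_le_of_sum_le fun s =>
    sum_abs_apply_ind_le f s (fun k : ℕ => ({k} : Set ℕ))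
      (fun k _ => mem_adAlgebra_of_finite (Set.finite_singleton k))
      fun _ _ _ _ hkl => Set.disjoint_singleton.2 hkl

theorem norm_smul_diracFunctional_le {K : Type*} [TopologicalSpace K] [CompactSpace K] (a : ℝ)
    (t : K) : ‖a • diracFunctional t‖ ≤ |a| := by
  rw [norm_smul, Real.norm_eq_abs]
  exact mul_le_of_le_one_right (abs_nonneg a) (norm_diracFunctional_le t)

theorem summable_smul_diracFunctional {a : ℕ → ℝ} (ha : Summable fun k => |a k|) :
    Summable fun k => a k • diracFunctional (natPoint F k) :=
  Summable.of_norm_bounded ha fun _ => norm_smul_diracFunctional_le _ _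

/-- The projection of `C(K_F)^*` onto `ℓ₁(ℕ)`. -/
def ell1Proj (F : Set (Set ℕ)) : NormedDual C(KSpace F, ℝ) →L[ℝ] NormedDual C(KSpace F, ℝ) :=
  LinearMap.mkContinuous
    { toFun := fun f => ∑' k : ℕ, f (ind F {k}) • diracFunctional (natPoint F k)
      map_add' := fun f g => by
        rw [← (summable_smul_diracFunctional (summable_abs_apply_ind_singleton f)).tsum_add
          (summable_smul_diracFunctional (summable_abs_apply_ind_singleton g))]
        simp [add_smul]
      map_smul' := fun c f => by
        rw [RingHom.id_apply,
          ← (summable_smul_diracFunctional (summable_abs_apply_ind_singleton f)).tsum_const_smul c]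
        simp [mul_smul] }
    1 fun f => by
      rw [one_mul]
      exact (tsum_of_norm_bounded (summable_abs_apply_ind_singleton f).hasSum
        fun _ => norm_smul_diracFunctional_le _ _).trans (tsum_abs_apply_ind_singleton_le f)

theorem hasSum_ell1Proj (f : NormedDual C(KSpace F, ℝ)) :
    HasSum (fun k : ℕ => f (ind F {k}) • diracFunctional (natPoint F k)) (ell1Proj F f) :=
  (summable_smul_diracFunctional (summable_abs_apply_ind_singleton f)).hasSum

theorem ell1Proj_mem (f : NormedDual C(KSpace F, ℝ)) : ell1Proj F f ∈ ell1Nat F :=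
  ⟨_, summable_abs_apply_ind_singleton f, hasSum_ell1Proj f⟩

theorem ell1Proj_diracFunctional_natPoint (n : ℕ) :
    ell1Proj F (diracFunctional (natPoint F n)) = diracFunctional (natPoint F n) := by
  classical
  refine (hasSum_ell1Proj _).unique ?_
  have h : ∀ k : ℕ, diracFunctional (natPoint F n) (ind F {k}) = if k = n then 1 else 0 := by
    intro k
    rw [diracFunctional_apply, ind_natPoint (mem_adAlgebra_of_finite (Set.finite_singleton k)),
      Set.indicator_apply]
    simp [eq_comm]
  simp only [h]
  convert hasSum_ite_eq n (diracFunctional (natPoint F n)) using 2 with k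
  by_cases hk : k = n <;> simp [hk]

theorem ind_inftyPoint (hF : IsAlmostDisjointFamily F) {A : Set ℕ} (hA : A ∈ adAlgebra F)
    (hs : IsSmall F A) : ind F A (inftyPoint hF) = 0 := by
  have h : ¬ StoneSpace.toFun (inftyPoint hF) ⟨A, hA⟩ = true := by
    rw [inftyPoint, StoneSpace.toFun_ofPred]
    exact not_not.2 hs
  simp only [ind, dif_pos hA, StoneSpace.indicator_apply, if_neg h]

theorem ell1Proj_diracFunctional_inftyPoint (hF : IsAlmostDisjointFamily F) :
    ell1Proj F (diracFunctional (inftyPoint hF)) = 0 := by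
  refine (hasSum_ell1Proj _).unique ?_
  have h : ∀ k : ℕ, diracFunctional (inftyPoint hF) (ind F {k}) = 0 := fun k =>
    ind_inftyPoint hF (mem_adAlgebra_of_finite (Set.finite_singleton k))
      ⟨∅, Set.empty_subset _, Set.finite_empty, (Set.finite_singleton k).subset Set.sdiff_subset⟩
  simpa only [h, zero_smul] using hasSum_zero

/-- The subspace `ℓ₁(ℕ) ⊕ ℝ δ_∞` of `C(K_F)^*`. -/
def ell1Infty (hF : IsAlmostDisjointFamily F) : Submodule ℝ (NormedDual C(KSpace F, ℝ)) :=
  (Submodule.span ℝ {diracFunctional (inftyPoint hF)}).comap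
    (ContinuousLinearMap.id ℝ (NormedDual C(KSpace F, ℝ)) - ell1Proj F).toLinearMap

/-- The coefficient of `δ_∞` of a member of `ℓ₁(ℕ) ⊕ ℝ δ_∞`. -/
def inftyCoeff (F : Set (Set ℕ)) : NormedDual C(KSpace F, ℝ) →ₗ[ℝ] ℝ :=
  (ContinuousLinearMap.apply ℝ ℝ (1 : C(KSpace F, ℝ))).toLinearMap ∘ₗ
    (ContinuousLinearMap.id ℝ (NormedDual C(KSpace F, ℝ)) - ell1Proj F).toLinearMap

theorem inftyCoeff_apply (f : NormedDual C(KSpace F, ℝ)) :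
    inftyCoeff F f = f 1 - ell1Proj F f 1 := rfl

theorem mem_ell1Infty_iff (hF : IsAlmostDisjointFamily F) {f : NormedDual C(KSpace F, ℝ)} :
    f ∈ ell1Infty hF ↔ f - ell1Proj F f = inftyCoeff F f • diracFunctional (inftyPoint hF) := by
  rw [ell1Infty, Submodule.mem_comap, Submodule.mem_span_singleton]
  change (∃ a : ℝ, _ = f - ell1Proj F f) ↔ _
  refine ⟨?_, fun h => ⟨_, h.symm⟩⟩
  rintro ⟨a, ha⟩
  have h : a = inftyCoeff F f := by
    rw [inftyCoeff_apply, ← sub_apply, ← ha]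
    simp [diracFunctional_apply]
  rw [← h, ha]

theorem isClosed_ell1Infty (hF : IsAlmostDisjointFamily F) :
    IsClosed (ell1Infty hF : Set (NormedDual C(KSpace F, ℝ))) :=
  (Submodule.closed_of_finiteDimensional
    (Submodule.span ℝ {diracFunctional (inftyPoint hF)})).preimage
    (ContinuousLinearMap.id ℝ (NormedDual C(KSpace F, ℝ)) - ell1Proj F).continuous

theorem diracFunctional_natPoint_mem_ell1Infty (hF : IsAlmostDisjointFamily F) (n : ℕ) :
    diracFunctional (natPoint F n) ∈ ell1Infty hF := by
  rw [mem_ell1Infty_iff, inftyCoeff_apply, ell1Proj_diracFunctional_natPoint]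
  simp

theorem isNormingSubspace_ell1Infty (hF : IsAlmostDisjointFamily F) :
    IsNormingSubspace (ell1Infty hF) := by
  refine ⟨1, 1, one_pos, one_pos, fun x => ?_⟩
  rw [one_mul]
  have hub : ∀ r ∈ (fun f : NormedDual C(KSpace F, ℝ) => f x) '' {f | f ∈ ell1Infty hF ∧ ‖f‖ ≤ 1},
      r ≤ ‖x‖ := by
    rintro _ ⟨f, hf, rfl⟩
    calc f x ≤ ‖f x‖ := le_abs_self _
      _ ≤ ‖f‖ * ‖x‖ := f.le_opNorm x
      _ ≤ ‖x‖ := mul_le_of_le_one_left (norm_nonneg x) hf.2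
  have hle : ∀ f ∈ ell1Infty hF, ‖f‖ ≤ 1 →
      f x ≤ sSup ((fun f : NormedDual C(KSpace F, ℝ) => f x) '' {f | f ∈ ell1Infty hF ∧ ‖f‖ ≤ 1}) :=
    fun f hf h => le_csSup ⟨_, hub⟩ ⟨f, ⟨hf, h⟩, rfl⟩
  refine ⟨norm_le_of_natPoint ?_ fun n => abs_le'.2 ⟨?_, ?_⟩, csSup_le ⟨_, 0, ?_, rfl⟩ hub⟩
  · simpa using hle 0 (Submodule.zero_mem _) (by simp)
  · exact hle _ (diracFunctional_natPoint_mem_ell1Infty hF n) (norm_diracFunctional_le _)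
  · exact hle _ ((ell1Infty hF).neg_mem (diracFunctional_natPoint_mem_ell1Infty hF n))
      (by rw [norm_neg]; exact norm_diracFunctional_le _)
  · exact ⟨Submodule.zero_mem _, by simp⟩

/-- Along weak-star convergent sequences in `ℓ₁(ℕ) ⊕ ℝ δ_∞` the coefficient of `δ_∞` converges,
provided that `δ_∞` is not a weak-star sequential limit of `ℓ₁(ℕ)`. -/
theorem tendsto_inftyCoeff (hF : IsAlmostDisjointFamily F)
    (hinf : ¬ ∃ x : ℕ → NormedDual C(KSpace F, ℝ), (∀ i, x i ∈ ell1Nat F) ∧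
        Tendsto (fun i => StrongDual.toWeakDual (x i)) atTop
          (𝓝 (StrongDual.toWeakDual (diracFunctional (inftyPoint hF)))))
    {u : ℕ → NormedDual C(KSpace F, ℝ)} {v : NormedDual C(KSpace F, ℝ)}
    (hu : ∀ n, u n ∈ ell1Infty hF) (hv : v ∈ ell1Infty hF)
    (huv : ∀ x, Tendsto (fun n => u n x) atTop (𝓝 (v x))) :
    Tendsto (fun n => inftyCoeff F (u n)) atTop (𝓝 (inftyCoeff F v)) := by
  by_contra hcon
  obtain ⟨ε, hε, hfr⟩ : ∃ ε > 0, ∃ᶠ n in atTop, ε ≤ |inftyCoeff F (v - u n)| := by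
    rw [Metric.tendsto_nhds] at hcon
    push Not at hcon
    obtain ⟨ε, hε, h⟩ := hcon
    refine ⟨ε, hε, h.mono fun n hn => ?_⟩
    rwa [map_sub, abs_sub_comm, ← Real.dist_eq]
  obtain ⟨φ, hφ, hφε⟩ := extraction_of_frequently_atTop hfr
  set c : ℕ → ℝ := fun n => inftyCoeff F (v - u (φ n)) with hc
  have hc0 : ∀ n, c n ≠ 0 := fun n => abs_pos.1 (hε.trans_le (hφε n))
  -- After division by the coefficient `c n` of `v - u (φ n)`, the `ℓ₁` part of the negative is
  -- `δ_∞` minus a weak-star null term, as `|c n| ≥ ε`.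
  refine hinf ⟨fun n => ell1Proj F (-(c n)⁻¹ • (v - u (φ n))), fun n => ell1Proj_mem _, ?_⟩
  refine tendsto_toWeakDual_iff.2 fun x => ?_
  have hP : ∀ n, ell1Proj F (-(c n)⁻¹ • (v - u (φ n))) x =
      diracFunctional (inftyPoint hF) x - (c n)⁻¹ * (v x - u (φ n) x) := by
    intro n
    have h := (mem_ell1Infty_iff hF).1 ((ell1Infty hF).sub_mem hv (hu (φ n)))
    have h' : ell1Proj F (v - u (φ n)) =
        (v - u (φ n)) - c n • diracFunctional (inftyPoint hF) := by
      rw [← h]; abel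
    rw [map_smul, h']
    simp only [smul_apply, sub_apply, smul_eq_mul]
    field_simp [hc0 n]
    ring
  simp only [hP]
  suffices h : Tendsto (fun n => (c n)⁻¹ * (v x - u (φ n) x)) atTop (𝓝 0) by
    simpa using h.const_sub (diracFunctional (inftyPoint hF) x)
  have hz : Tendsto (fun n => v x - u (φ n) x) atTop (𝓝 0) := by
    simpa using ((huv x).comp hφ.tendsto_atTop).const_sub (v x)
  refine bdd_le_mul_tendsto_zero' (ε⁻¹) (Eventually.of_forall fun n => ?_) hz
  rw [abs_inv]
  exact inv_anti₀ hε (hφε n)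

/-- The values on `1_{k}` determine the `ℓ₁` part, and the value at `1` then determines the
coefficient. So countably many functions separate the points of `Y`. -/
theorem eq_of_apply_gens_eq (hF : IsAlmostDisjointFamily F) {f g : NormedDual C(KSpace F, ℝ)}
    (hf : f ∈ ell1Infty hF) (hg : g ∈ ell1Infty hF) (h1 : f 1 = g 1)
    (h : ∀ k : ℕ, f (ind F {k}) = g (ind F {k})) : f = g := by
  have hP : ell1Proj F f = ell1Proj F g :=
    (hasSum_ell1Proj f).unique (by simpa only [h] using hasSum_ell1Proj g)
  have hf' := (mem_ell1Infty_iff hF).1 hf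
  have hg' := (mem_ell1Infty_iff hF).1 hg
  rw [inftyCoeff_apply, hP, h1] at hf'
  rw [inftyCoeff_apply, ← hf'] at hg'
  exact (sub_left_injective hg').symm

theorem not_fullyMackeyComplete (hF : IsAlmostDisjointFamily F)
    (hinf : ¬ ∃ x : ℕ → NormedDual C(KSpace F, ℝ), (∀ i, x i ∈ ell1Nat F) ∧
        Tendsto (fun i => StrongDual.toWeakDual (x i)) atTop
          (𝓝 (StrongDual.toWeakDual (diracFunctional (inftyPoint hF))))) :
    ¬ FullyMackeyComplete C(KSpace F, ℝ) := by
  intro hcomplete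
  obtain ⟨x, hx⟩ := exists_forall_apply_eq_of_completeSpace (ell1Infty hF)
    (hcomplete _ (isNormingSubspace_ell1Infty hF) (isClosed_ell1Infty hF))
    (inftyCoeff F ∘ₗ WeakDual.toStrongDual.toLinearMap) (by
      intro K hK
      have hKc : CompactSpace K := isCompact_iff_compactSpace.1 hK.2.2
      -- `Θ` embeds the compact set `K` in a metrizable space, so sequences suffice to test
      -- continuity.
      let Θ : K → (ℕ → ℝ) × ℝ := fun f =>
        (fun k => (f : WeakDual ℝ C(KSpace F, ℝ)) (ind F {k}),
          (f : WeakDual ℝ C(KSpace F, ℝ)) 1)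
      have hΘ : Continuous Θ :=
        (continuous_pi fun k => (WeakDual.eval_continuous _).comp continuous_subtype_val).prodMk
          ((WeakDual.eval_continuous _).comp continuous_subtype_val)
      have hinj : Function.Injective Θ := fun f g hfg =>
        Subtype.ext (WeakDual.toStrongDual.injective (eq_of_apply_gens_eq hF (hK.1 f f.2)
          (hK.1 g g.2) (congrArg Prod.snd hfg) fun k => congrFun (congrArg Prod.fst hfg) k))
      have := (hΘ.isClosedEmbedding hinj).isInducing.firstCountableTopology
      rw [continuousOn_iff_continuous_domRestrict, continuous_iff_seqContinuous]
      intro u v huv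
      refine tendsto_inftyCoeff hF hinf (fun n => hK.1 _ (u n).2) (hK.1 _ v.2) fun y => ?_
      exact ((WeakDual.eval_continuous y).comp continuous_subtype_val).continuousAt.tendsto.comp
        huv)
  -- Each `f` in `Y` lies in an admissible compact set, the segment from `-f` to `f`.
  have hmem : ∀ f ∈ ell1Infty hF, f x = inftyCoeff F f := by
    intro f hf
    refine hx ((fun a : ℝ => a • StrongDual.toWeakDual f) '' Set.Icc (-1) 1) ⟨?_, ⟨?_, ?_⟩, ?_⟩
      (StrongDual.toWeakDual f) ⟨1, by simp, one_smul _ _⟩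
    · rintro _ ⟨a, -, rfl⟩
      exact (ell1Infty hF).smul_mem a hf
    · rw [balanced_iff_smul_mem]
      rintro a ha _ ⟨b, hb, rfl⟩
      refine ⟨a * b, ?_, mul_smul _ _ _⟩
      rw [Set.mem_Icc, ← abs_le] at hb ⊢
      rw [abs_mul]
      exact mul_le_one₀ ha (abs_nonneg b) hb
    · exact (convex_Icc (-1 : ℝ) 1).is_linear_image (IsLinearMap.isLinearMap_smul' _)
    · exact isCompact_Icc.image (continuous_id.smul continuous_const)
  have hx0 : x = 0 := ext_natPoint fun n => by
    have h := hmem _ (diracFunctional_natPoint_mem_ell1Infty hF n)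
    rwa [inftyCoeff_apply, ell1Proj_diracFunctional_natPoint, sub_self] at h
  have hone : inftyCoeff F (diracFunctional (inftyPoint hF)) = 1 := by
    rw [inftyCoeff_apply, ell1Proj_diracFunctional_inftyPoint]
    simp [diracFunctional_apply]
  have h := hmem (diracFunctional (inftyPoint hF)) (by
    rw [mem_ell1Infty_iff, hone, ell1Proj_diracFunctional_inftyPoint, sub_zero, one_smul])
  rw [hone, hx0, map_zero] at h
  exact zero_ne_one h

/-! ### The main theorem -/

theorem AvoidsInfty.not_tendsto (hF : IsAlmostDisjointFamily F) (hav : AvoidsInfty F) :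
    ¬ ∃ x : ℕ → NormedDual C(KSpace F, ℝ), (∀ i, x i ∈ ell1Nat F) ∧
        Tendsto (fun i => StrongDual.toWeakDual (x i)) atTop
          (𝓝 (StrongDual.toWeakDual (diracFunctional (inftyPoint hF)))) := by
  rintro ⟨x, hx, hlim⟩
  choose a ha hax using hx
  have hval : ∀ i (A : Set ℕ), A ∈ adAlgebra F → x i (ind F A) = ∑' k, A.indicator (a i) k := by
    intro i A hA
    have h := (ContinuousLinearMap.apply ℝ ℝ (ind F A)).hasSum (hax i)
    refine h.tsum_eq.symm.trans (tsum_congr fun k => ?_)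
    by_cases hk : k ∈ A <;> simp [diracFunctional_apply, ind_natPoint hA, hk]
  have hconv : ∀ A ∈ adAlgebra F,
      Tendsto (fun i => ∑' k, A.indicator (a i) k) atTop (𝓝 (ind F A (inftyPoint hF))) := by
    intro A hA
    have h := tendsto_toWeakDual_iff.1 hlim (ind F A)
    simpa only [hval _ A hA, diracFunctional_apply] using h
  obtain ⟨N, hN, hnot⟩ := hav a ha (fun k => by
      have hk := mem_adAlgebra_of_finite (F := F) (Set.finite_singleton k)
      have h := hconv {k} hk
      rw [ind_inftyPoint hF hk ⟨∅, Set.empty_subset _, Set.finite_empty,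
        (Set.finite_singleton k).subset Set.sdiff_subset⟩] at h
      refine h.congr fun i => ?_
      rw [tsum_eq_single k fun l hl => Set.indicator_of_notMem (by simpa using hl) _]
      simp) (by
      have h := hconv Set.univ (adAlgebra F).top_mem
      simpa [ind_univ] using h)
  have h := hconv N (mem_adAlgebra hN)
  rw [ind_inftyPoint hF (mem_adAlgebra hN) ⟨{N}, by simpa using hN, Set.finite_singleton N,
    by simp⟩] at h
  exact hnot h

end

theorem mainTheorem8 (CH : Cardinal.continuum.{0} = Cardinal.aleph 1) :
    ∃ (F : Set (Set ℕ)) (hF : IsMaximalAlmostDisjointFamily F),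
      (¬ ∃ x : ℕ → NormedDual C(KSpace F, ℝ), (∀ i, x i ∈ ell1Nat F) ∧
        Tendsto (fun i => StrongDual.toWeakDual (x i)) atTop
          (𝓝 (StrongDual.toWeakDual (diracFunctional (inftyPoint hF.prop))))) ∧
      HasPropertyEPrime C(KSpace F, ℝ) ∧
      ¬ FullyMackeyComplete C(KSpace F, ℝ) := by
  obtain ⟨F₁, hF₁, hav⟩ := exists_isAlmostDisjointFamily_avoidsInfty CH
  -- Avoidance is witnessed by single members of the family, so it survives the enlargement.
  obtain ⟨F, hle, hF⟩ := hF₁.exists_maximal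
  have hinf := (hav.mono hle).not_tendsto hF.prop
  exact ⟨F, hF, hinf, hasPropertyEPrime_of_isAlmostDisjointFamily hF.prop,
    not_fullyMackeyComplete hF.prop hinf⟩
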